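/- Let $M$ be a smooth (Hausdorff, second countable, finite-dimensional) manifold and let $D\subset TM$ be a Lie subalgebroid, i.e. a smooth subbundle of constant rank whose sections are closed under the Lie bracket of vector fields. Let $\Omega^k(D)=\Gamma(\Lambda^kD^*)$, let $d_D$ be the Lie algebroid differential given by the Cartan formula, and let $H^3(D)=\ker(d_D|_{\Omega^3(D)})/d_D\Omega^2(D)$. A Courant algebroid over $M$ is a smooth real vector bundle $E\to M$ of finite rank with a nondegenerate symmetric bilinear form $\langle\cdot,\cdot\rangle$ on its fibres, a bundle map $\rho:E\to TM$ (the anchor) and an $\mathbb R$-bilinear bracket on $\Gamma(E)$ such that, for all $\phi,\psi,\psi_1,\psi_2\in\Gamma(E)$ and $f\in C^\infty(M)$, $$[\phi,[\psi_1,\psi_2]]=[[\phi,\psi_1],\psi_2]+[\psi_1,[\phi,\psi_2]],\qquad [\phi,f\psi]=(\rho(\phi)f)\psi+f[\phi,\psi],$$ $$[\phi,\phi]=\tfrac12\rho^*d\langle\phi,\phi\rangle,\qquad \rho(\phi)\langle\psi,\psi\rangle=2\langle[\phi,\psi],\psi\rangle,$$ where $\langle\rho^*\alpha,\psi\rangle=\alpha(\rho\psi)$.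 It is generalized exact if $\rho$ has constant rank and the sequence $0\to(\operatorname{im}\rho)^*\xrightarrow{\rho^*}E\xrightarrow{\rho}\operatorname{im}\rho\to0$ is exact. An isomorphism of Courant algebroids over $M$ is an isomorphism of vector bundles over the identity of $M$ that preserves the anchor, the bilinear form and the bracket. Then every generalized exact Courant algebroid $E$ over $M$ with $\operatorname{im}\rho=D$ has an isotropic section of its anchor, that is, a bundle map $\sigma:D\to E$ with $\rho\circ\sigma=\mathrm{id}_D$ and $\langle\sigma X,\sigma Y\rangle=0$ for all $X,Y$. For each such $\sigma$, the formula $C_\sigma(X,Y,Z)=\langle[\sigma X,\sigma Y]-\sigma[X,Y],\sigma Z\rangle$ for $X,Y,Z\in\Gamma(D)$ defines a closed form $C_\sigma\in\Omega^3(D)$, whose class $[C]=[C_\sigma]\in H^3(D)$ (the Ševera class of $E$) does not depend on $\sigma$. The assignment $E\mapsto[C]$ induces a bijection from the set of isomorphism classes of generalized exact Courant algebroids over $M$ with $\operatorname{im}\rho=D$ onto $H^3(D)$. -/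

import Mathlib

open Bundle
open scoped Manifold ContDiff

universe u v

noncomputable section

namespace Courant

variable {n : ℕ} {M : Type u} [TopologicalSpace M] [ChartedSpace (EuclideanSpace ℝ (Fin n)) M]
  [IsManifold (𝓡 n) ∞ M]

/-- Smooth vector fields on `M`. -/
abbrev SmoothVectorField (n : ℕ) (M : Type u) [TopologicalSpace M]
    [ChartedSpace (EuclideanSpace ℝ (Fin n)) M] [IsManifold (𝓡 n) ∞ M] : Type u :=
  ContMDiffSection (𝓡 n) (EuclideanSpace ℝ (Fin n)) ∞ (fun x : M => TangentSpace (𝓡 n) x)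

/-- The derivative of the function `f` at `x` in the direction of the tangent vector `w`. -/
def dirDeriv (f : M → ℝ) (x : M) (w : TangentSpace (𝓡 n) x) : ℝ :=
  mfderiv (𝓡 n) 𝓘(ℝ, ℝ) f x w

/-- The Lie bracket of two smooth vector fields. -/
def lieBracket (X Y : SmoothVectorField n M) : SmoothVectorField n M where
  toFun := VectorField.mlieBracket (𝓡 n) X Y
  contMDiff_toFun := by
    have h2 : IsManifold (𝓡 n) (minSmoothness ℝ 2) M := by
      rw [minSmoothness_of_isRCLikeNormedField]
      infer_instance
    have h3 : IsManifold (𝓡 n) (minSmoothness ℝ 3) M := by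
      rw [minSmoothness_of_isRCLikeNormedField]
      infer_instance
    have h4 : IsManifold (𝓡 n) ((⊤ : ℕ∞) + 1) M := by simpa using ‹IsManifold (𝓡 n) ∞ M›
    intro x
    exact ContMDiffAt.mlieBracket_vectorField (m := (⊤ : ℕ∞)) (n := (⊤ : ℕ∞))
      X.contMDiff.contMDiffAt Y.contMDiff.contMDiffAt (by simp)

/-! ### Lie subalgebroids of the tangent bundle and their cohomology -/

/-- A Lie subalgebroid of `TM`: a smooth subbundle of `TM` (of constant rank) whose sections are
closed under the Lie bracket of vector fields. -/
structure LieSubalgebroid (n : ℕ) (M : Type u) [TopologicalSpace M]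
    [ChartedSpace (EuclideanSpace ℝ (Fin n)) M] [IsManifold (𝓡 n) ∞ M] where
  /-- The fibre over a point. -/
  fiber : ∀ x : M, Submodule ℝ (TangentSpace (𝓡 n) x)
  /-- The fibres are locally spanned by `r` smooth, pointwise independent vector fields. -/
  subbundle : ∃ r : ℕ, ∀ x₀ : M, ∃ U : Set M, IsOpen U ∧ x₀ ∈ U ∧
    ∃ e : Fin r → ∀ x : M, TangentSpace (𝓡 n) x,
      (∀ i, ContMDiffOn (𝓡 n) (𝓡 n).tangent ∞ (fun x => (⟨x, e i x⟩ : TangentBundle (𝓡 n) M)) U) ∧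
      ∀ x ∈ U, LinearIndependent ℝ (fun i => e i x) ∧
        Submodule.span ℝ (Set.range fun i => e i x) = fiber x
  involutive : ∀ X Y : SmoothVectorField n M, (∀ x, X x ∈ fiber x) → (∀ x, Y x ∈ fiber x) →
    ∀ x, lieBracket X Y x ∈ fiber x

namespace LieSubalgebroid

variable (D : LieSubalgebroid n M)

/-- `Γ(D)`: the smooth sections of `D`, that is, the smooth vector fields tangent to `D`. -/
def Sections : Submodule ℝ (SmoothVectorField n M) where
  carrier := {X | ∀ x, X x ∈ D.fiber x}
  add_mem' := fun hX hY x => (D.fiber x).add_mem (hX x) (hY x)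
  zero_mem' := fun x => (D.fiber x).zero_mem
  smul_mem' := fun c _ hX x => (D.fiber x).smul_mem c (hX x)

variable {D}

/-- The value of a section of `D` at a point. -/
def val (X : D.Sections) (x : M) : D.fiber x := ⟨X.1 x, X.2 x⟩

/-- The bracket of the Lie algebroid `D`. -/
def bracket (X Y : D.Sections) : D.Sections :=
  ⟨lieBracket X.1 Y.1, D.involutive X.1 Y.1 X.2 Y.2⟩

variable (D)

/-- The space `Ω^k(D) = Γ(Λ^k D^*)` inside all families of alternating `k`-forms on the fibres of
`D`: the families that are smooth, in the sense that their values on smooth sections of `D` are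
smooth functions. -/
def formSubmodule (k : ℕ) : Submodule ℝ (∀ x : M, (D.fiber x) [⋀^Fin k]→ₗ[ℝ] ℝ) where
  carrier := {θ | ∀ X : Fin k → D.Sections,
    ContMDiff (𝓡 n) 𝓘(ℝ, ℝ) ∞ (fun x => θ x (fun i => val (X i) x))}
  add_mem' := fun hθ hη X => (hθ X).add (hη X)
  zero_mem' := fun _ => contMDiff_const
  smul_mem' := fun _ _ hθ X => contMDiff_const.mul (hθ X)

/-- `Ω^k(D) = Γ(Λ^k D^*)`: the smooth `k`-forms on `D`. -/
def Form (k : ℕ) : Type u := D.formSubmodule k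

instance (k : ℕ) : AddCommGroup (D.Form k) := Submodule.addCommGroup (D.formSubmodule k)

instance (k : ℕ) : Module ℝ (D.Form k) := Submodule.module (D.formSubmodule k)

variable {D}

/-- The function obtained by evaluating a `D`-form on sections of `D`. -/
def eval {k : ℕ} (θ : D.Form k) (X : Fin k → D.Sections) (x : M) : ℝ :=
  θ.1 x (fun i => val (X i) x)

/-- The Cartan formula for `(d_D θ)(X_0, …, X_{k+1})`, where `θ` is a `(k+1)`-form on `D`:
`∑_i (-1)^i X_i(θ(X_0, …, X̂_i, …)) + ∑_{i<j} (-1)^{i+j} θ([X_i, X_j], …, X̂_i, …, X̂_j, …)`.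
The pair `i < j` is indexed by `(i, j - 1)`, whence the minus sign in front of the second sum. -/
def d {k : ℕ} (θ : D.Form (k + 1)) (X : Fin (k + 2) → D.Sections) (x : M) : ℝ :=
  (∑ i : Fin (k + 2), (-1 : ℝ) ^ (i : ℕ) * dirDeriv (eval θ (i.removeNth X)) x ((X i).1 x)) -
    ∑ i : Fin (k + 1), ∑ j ∈ Finset.univ.filter (fun j : Fin (k + 1) => i ≤ j),
      (-1 : ℝ) ^ ((i : ℕ) + (j : ℕ)) *
        eval θ (Matrix.vecCons (bracket (X i.castSucc) (X j.succ))
          (j.removeNth (i.castSucc.removeNth X))) x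

theorem eval_mdiff {k : ℕ} (θ : D.Form k) (X : Fin k → D.Sections) (x : M) :
    MDifferentiableAt (𝓡 n) 𝓘(ℝ, ℝ) (eval θ X) x :=
  (θ.2 X).mdifferentiableAt (by simp)

theorem d_zero {k : ℕ} (X : Fin (k + 2) → D.Sections) (x : M) :
    d (0 : D.Form (k + 1)) X x = 0 := by
  have h : ∀ Y : Fin (k + 1) → D.Sections,
      eval (0 : D.Form (k + 1)) Y = fun _ : M => (0 : ℝ) := fun Y => rfl
  have h' : ∀ (Y : Fin (k + 1) → D.Sections) (w : TangentSpace (𝓡 n) x),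
      dirDeriv (eval (0 : D.Form (k + 1)) Y) x w = 0 := by
    intro Y w
    rw [h, dirDeriv, mfderiv_const]
    rfl
  simp only [d, h']
  simp [h]

theorem d_add {k : ℕ} (θ η : D.Form (k + 1)) (X : Fin (k + 2) → D.Sections) (x : M) :
    d (θ + η) X x = d θ X x + d η X x := by
  have h : ∀ Y : Fin (k + 1) → D.Sections, eval (θ + η) Y = eval θ Y + eval η Y := fun Y => rfl
  have h' : ∀ (Y : Fin (k + 1) → D.Sections) (w : TangentSpace (𝓡 n) x),
      dirDeriv (eval θ Y + eval η Y) x w = dirDeriv (eval θ Y) x w + dirDeriv (eval η Y) x w := by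
    intro Y w
    simp only [dirDeriv]
    rw [mfderiv_add (eval_mdiff θ Y x) (eval_mdiff η Y x)]
    rfl
  simp only [d, h, h', Pi.add_apply, mul_add, Finset.sum_add_distrib]
  ring

theorem d_smul {k : ℕ} (c : ℝ) (θ : D.Form (k + 1)) (X : Fin (k + 2) → D.Sections) (x : M) :
    d (c • θ) X x = c * d θ X x := by
  have h : ∀ Y : Fin (k + 1) → D.Sections, eval (c • θ) Y = c • eval θ Y := fun Y => rfl
  have h' : ∀ (Y : Fin (k + 1) → D.Sections) (w : TangentSpace (𝓡 n) x),
      dirDeriv (c • eval θ Y) x w = c * dirDeriv (eval θ Y) x w := by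
    intro Y w
    simp only [dirDeriv]
    rw [const_smul_mfderiv (eval_mdiff θ Y x) c]
    rfl
  simp only [d, h, h', Pi.smul_apply, smul_eq_mul, mul_sub, Finset.mul_sum]
  simp only [mul_left_comm]

variable (D)

/-- `Z³(D)`: the `d_D`-closed `3`-forms on `D`. -/
def Z3 : Submodule ℝ (D.Form 3) where
  carrier := {θ | ∀ (X : Fin 4 → D.Sections) (x : M), d θ X x = 0}
  add_mem' := fun hθ hη X x => by rw [d_add, hθ X x, hη X x, add_zero]
  zero_mem' := fun X x => d_zero X x
  smul_mem' := fun c _ hθ X x => by rw [d_smul, hθ X x, mul_zero]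

/-- `B³(D)`: the `d_D`-exact `3`-forms on `D`. -/
def B3 : Submodule ℝ (D.Form 3) where
  carrier := {θ | ∃ β : D.Form 2, ∀ (X : Fin 3 → D.Sections) (x : M), eval θ X x = d β X x}
  add_mem' := by
    rintro θ η ⟨β, hβ⟩ ⟨γ, hγ⟩
    exact ⟨β + γ, fun X x => by rw [d_add, ← hβ, ← hγ]; rfl⟩
  zero_mem' := ⟨0, fun X x => by rw [d_zero]; rfl⟩
  smul_mem' := by
    rintro c θ ⟨β, hβ⟩
    exact ⟨c • β, fun X x => by rw [d_smul, ← hβ]; rfl⟩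

/-- `H³(D)`: closed `3`-forms modulo exact `3`-forms. -/
abbrev H3 : Type u := D.Z3 ⧸ D.B3.submoduleOf D.Z3

end LieSubalgebroid

/-! ### Courant algebroids -/

/-- A Courant algebroid structure on a smooth vector bundle `E → M` with model fibre `F`. -/
structure CourantStructure (n : ℕ) {M : Type u} [TopologicalSpace M]
    [ChartedSpace (EuclideanSpace ℝ (Fin n)) M] [IsManifold (𝓡 n) ∞ M]
    (F : Type v) [NormedAddCommGroup F] [NormedSpace ℝ F]
    (E : M → Type v) [TopologicalSpace (TotalSpace F E)] [∀ x, TopologicalSpace (E x)]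
    [∀ x, AddCommGroup (E x)] [∀ x, Module ℝ (E x)] [FiberBundle F E] [VectorBundle ℝ F E]
    [ContMDiffVectorBundle ∞ F E (𝓡 n)] where
  /-- The anchor `ρ : E → TM`. -/
  anchor : ∀ x, E x →ₗ[ℝ] TangentSpace (𝓡 n) x
  /-- The pseudo-metric. -/
  pairing : ∀ x, E x →ₗ[ℝ] E x →ₗ[ℝ] ℝ
  /-- The bracket on the smooth sections. -/
  bracket : ContMDiffSection (𝓡 n) F ∞ E →ₗ[ℝ] ContMDiffSection (𝓡 n) F ∞ E →ₗ[ℝ]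
    ContMDiffSection (𝓡 n) F ∞ E
  anchor_smooth : ∀ φ : ContMDiffSection (𝓡 n) F ∞ E,
    ContMDiff (𝓡 n) (𝓡 n).tangent ∞ (fun x => (⟨x, anchor x (φ x)⟩ : TangentBundle (𝓡 n) M))
  pairing_smooth : ∀ φ ψ : ContMDiffSection (𝓡 n) F ∞ E,
    ContMDiff (𝓡 n) 𝓘(ℝ, ℝ) ∞ (fun x => pairing x (φ x) (ψ x))
  pairing_symm : ∀ x v w, pairing x v w = pairing x w v
  pairing_nondegenerate : ∀ x v, (∀ w, pairing x v w = 0) → v = 0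
  /-- `[φ, [ψ₁, ψ₂]] = [[φ, ψ₁], ψ₂] + [ψ₁, [φ, ψ₂]]` -/
  jacobi : ∀ φ ψ₁ ψ₂, bracket φ (bracket ψ₁ ψ₂) =
    bracket (bracket φ ψ₁) ψ₂ + bracket ψ₁ (bracket φ ψ₂)
  /-- `[φ, f ψ] = ρ(φ)f · ψ + f [φ, ψ]`; here `fψ` is the section `χ`. -/
  leibniz : ∀ (φ ψ χ : ContMDiffSection (𝓡 n) F ∞ E) (f : M → ℝ),
    ContMDiff (𝓡 n) 𝓘(ℝ, ℝ) ∞ f → (∀ x, χ x = f x • ψ x) →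
    ∀ x, bracket φ χ x = dirDeriv f x (anchor x (φ x)) • ψ x + f x • bracket φ ψ x
  /-- `[φ, φ] = ½ ρ^* d⟨φ, φ⟩`, where `⟨ρ^* α, ψ⟩ = α(ρ ψ)`. -/
  bracket_self : ∀ (φ : ContMDiffSection (𝓡 n) F ∞ E) (x : M) (w : E x),
    pairing x (bracket φ φ x) w =
      (1 / 2) * dirDeriv (fun y => pairing y (φ y) (φ y)) x (anchor x w)
  /-- `ρ(φ)⟨ψ, ψ⟩ = 2 ⟨[φ, ψ], ψ⟩` -/
  invariant : ∀ (φ ψ : ContMDiffSection (𝓡 n) F ∞ E) (x : M),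
    dirDeriv (fun y => pairing y (ψ y) (ψ y)) x (anchor x (φ x)) =
      2 * pairing x (bracket φ ψ x) (ψ x)

/-- A Courant algebroid over `M`: a smooth real vector bundle of finite rank together with a
Courant algebroid structure. -/
structure CourantAlgebroid (n : ℕ) (M : Type u) [TopologicalSpace M]
    [ChartedSpace (EuclideanSpace ℝ (Fin n)) M] [IsManifold (𝓡 n) ∞ M] where
  /-- The model fibre of the bundle. -/
  F : Type v
  [normedAddCommGroup : NormedAddCommGroup F]
  [normedSpace : NormedSpace ℝ F]
  [finiteDimensional : FiniteDimensional ℝ F]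
  /-- The fibres of the bundle. -/
  E : M → Type v
  [topologicalSpaceTotal : TopologicalSpace (TotalSpace F E)]
  [topologicalSpace : ∀ x, TopologicalSpace (E x)]
  [addCommGroup : ∀ x, AddCommGroup (E x)]
  [module : ∀ x, Module ℝ (E x)]
  [fiberBundle : FiberBundle F E]
  [vectorBundle : VectorBundle ℝ F E]
  [contMDiffVectorBundle : ContMDiffVectorBundle ∞ F E (𝓡 n)]
  /-- The anchor, the pseudo-metric and the bracket. -/
  str : CourantStructure n F E

namespace CourantAlgebroid

attribute [instance] normedAddCommGroup normedSpace finiteDimensional topologicalSpaceTotal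
  topologicalSpace addCommGroup module fiberBundle vectorBundle contMDiffVectorBundle

/-- `Γ(A)`: the smooth sections of the bundle. -/
abbrev Sections (A : CourantAlgebroid.{u, v} n M) : Type (max u v) :=
  ContMDiffSection (𝓡 n) A.F ∞ A.E

/-- The image of the anchor over a point. -/
def image (A : CourantAlgebroid.{u, v} n M) (x : M) : Submodule ℝ (TangentSpace (𝓡 n) x) :=
  LinearMap.range (A.str.anchor x)

/-- Regularity: the anchor has constant rank. -/
def IsRegular (A : CourantAlgebroid.{u, v} n M) : Prop :=
  ∃ r : ℕ, ∀ x, Module.finrank ℝ (A.image x) = r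

/-- Generalized exactness: `A` is regular and `0 → (im ρ)^* → A → im ρ → 0` is exact, where
`ρ^* α` is determined by `⟨ρ^* α, w⟩ = α(ρ w)`. The map `ρ^*` is injective and `ρ` is onto its
image, so that what remains is exactness in the middle. -/
def IsGeneralizedExact (A : CourantAlgebroid.{u, v} n M) : Prop :=
  A.IsRegular ∧ ∀ (x : M) (v : A.E x), A.str.anchor x v = 0 ↔
    ∃ α : Module.Dual ℝ (A.image x),
      ∀ w : A.E x, A.str.pairing x v w = α ⟨A.str.anchor x w, LinearMap.mem_range_self _ w⟩

/-- An isomorphism of Courant algebroids over `M`: an isomorphism of smooth vector bundles over the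
identity of `M` that preserves the anchor, the pseudo-metric and the bracket. -/
structure Iso (A B : CourantAlgebroid.{u, v} n M) where
  /-- The fibrewise linear isomorphisms. -/
  toEquiv : ∀ x, A.E x ≃ₗ[ℝ] B.E x
  /-- The induced map on smooth sections. -/
  onSections : A.Sections ≃ B.Sections
  onSections_apply : ∀ (s : A.Sections) (x : M), onSections s x = toEquiv x (s x)
  anchor_comp : ∀ x v, B.str.anchor x (toEquiv x v) = A.str.anchor x v
  pairing_comp : ∀ x v w, B.str.pairing x (toEquiv x v) (toEquiv x w) = A.str.pairing x v w
  bracket_comp : ∀ s t : A.Sections,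
    onSections (A.str.bracket s t) = B.str.bracket (onSections s) (onSections t)

/-- The identity isomorphism. -/
def Iso.refl (A : CourantAlgebroid.{u, v} n M) : Iso A A where
  toEquiv := fun _ => LinearEquiv.refl ℝ _
  onSections := Equiv.refl _
  onSections_apply := fun _ _ => rfl
  anchor_comp := fun _ _ => rfl
  pairing_comp := fun _ _ _ => rfl
  bracket_comp := fun _ _ => rfl

/-- The inverse isomorphism. -/
def Iso.symm {A B : CourantAlgebroid.{u, v} n M} (Φ : Iso A B) : Iso B A where
  toEquiv := fun x => (Φ.toEquiv x).symm
  onSections := Φ.onSections.symm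
  onSections_apply := fun s x => by
    rw [LinearEquiv.eq_symm_apply, ← Φ.onSections_apply, Equiv.apply_symm_apply]
  anchor_comp := fun x v => by rw [← Φ.anchor_comp, LinearEquiv.apply_symm_apply]
  pairing_comp := fun x v w => by
    rw [← Φ.pairing_comp, LinearEquiv.apply_symm_apply, LinearEquiv.apply_symm_apply]
  bracket_comp := fun s t => by
    rw [Equiv.symm_apply_eq, Φ.bracket_comp, Equiv.apply_symm_apply, Equiv.apply_symm_apply]

/-- The composition of isomorphisms. -/
def Iso.trans {A B C : CourantAlgebroid.{u, v} n M} (Φ : Iso A B) (Ψ : Iso B C) : Iso A C where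
  toEquiv := fun x => (Φ.toEquiv x).trans (Ψ.toEquiv x)
  onSections := Φ.onSections.trans Ψ.onSections
  onSections_apply := fun s x => by
    simp only [Equiv.trans_apply, LinearEquiv.trans_apply, Ψ.onSections_apply, Φ.onSections_apply]
  anchor_comp := fun x v => by
    rw [LinearEquiv.trans_apply, Ψ.anchor_comp, Φ.anchor_comp]
  pairing_comp := fun x v w => by
    rw [LinearEquiv.trans_apply, LinearEquiv.trans_apply, Ψ.pairing_comp, Φ.pairing_comp]
  bracket_comp := fun s t => by
    rw [Equiv.trans_apply, Φ.bracket_comp, Ψ.bracket_comp]; rfl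

end CourantAlgebroid

/-! ### Generalized exact Courant algebroids with a given image of the anchor -/

/-- The generalized exact Courant algebroids over `M` with `im ρ = D`. -/
def GenExact (D : LieSubalgebroid n M) : Type (max u (v + 1)) :=
  {A : CourantAlgebroid.{u, v} n M // A.IsGeneralizedExact ∧ ∀ x, A.image x = D.fiber x}

namespace GenExact

variable {D : LieSubalgebroid n M}

variable (D) in
/-- Being isomorphic, as an equivalence relation. -/
def isoSetoid : Setoid (GenExact.{u, v} D) where
  r A B := Nonempty (CourantAlgebroid.Iso A.1 B.1)
  iseqv :=
    { refl := fun A => ⟨CourantAlgebroid.Iso.refl A.1⟩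
      symm := fun ⟨Φ⟩ => ⟨Φ.symm⟩
      trans := fun ⟨Φ⟩ ⟨Ψ⟩ => ⟨Φ.trans Ψ⟩ }

variable (D) in
/-- The isomorphism classes of generalized exact Courant algebroids with `im ρ = D`. -/
def IsoClasses : Type (max u (v + 1)) := Quotient (isoSetoid.{u, v} D)

/-- The isomorphism class of a generalized exact Courant algebroid. -/
def isoClass (A : GenExact.{u, v} D) : IsoClasses.{u, v} D := Quotient.mk (isoSetoid D) A

/-- An isotropic section `σ : D → A` of the anchor: a smooth bundle map, given on fibres and on
smooth sections. -/
structure IsotropicSection (A : GenExact.{u, v} D) where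
  /-- The fibrewise linear maps. -/
  toLin : ∀ x, D.fiber x →ₗ[ℝ] A.1.E x
  /-- The induced map on smooth sections. -/
  onSections : D.Sections → A.1.Sections
  onSections_apply : ∀ (X : D.Sections) (x : M), onSections X x = toLin x (LieSubalgebroid.val X x)
  anchor_toLin : ∀ x (v : D.fiber x), A.1.str.anchor x (toLin x v) = v
  isotropic : ∀ x (v w : D.fiber x), A.1.str.pairing x (toLin x v) (toLin x w) = 0

/-- `C` is the `3`-form `C_σ` of the isotropic section `σ`:
`C(X, Y, Z) = ⟨[σ X, σ Y] - σ [X, Y], σ Z⟩`. -/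
def IsotropicSection.IsSeveraForm {A : GenExact.{u, v} D} (σ : IsotropicSection A)
    (C : D.Form 3) : Prop :=
  ∀ (X Y Z : D.Sections) (x : M), LieSubalgebroid.eval C ![X, Y, Z] x =
    A.1.str.pairing x
      ((A.1.str.bracket (σ.onSections X) (σ.onSections Y) - σ.onSections (LieSubalgebroid.bracket X Y)) x)
      (σ.onSections Z x)

end GenExact

end Courant

end

/-!
An isotropic section `σ` of the anchor identifies `E` with `D ⊕ D^*`, by `v ↦ (ρ v, ⟨v, σ ·⟩)`.
This turns the pseudo-metric into the canonical pairing (`pairing_eq`) and the bracket into the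
Dorfman bracket twisted by the curvature `C(X, Y, Z) = ⟨[σ X, σ Y], σ Z⟩` (`split_bracket`). So `E`
is determined up to isomorphism by `C` (`isoOfCurvatureEq`), and everything reduces to the algebra
of the twisted Dorfman bracket.

* The Jacobiator of the twisted bracket is the Cartan differential of `C` (`dorfman_jacobiator`).
  Hence the curvature of a Courant algebroid is closed (`severaForm_mem_Z3`), and conversely every
  closed `C` twists the bracket on `D ⊕ D^*` to a Courant algebroid (`model`), in which the
  inclusion of `D` has curvature `C`.
* Two isotropic sections differ by a `2`-form `β`, every `2`-form occurs, and the curvature changes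
  by `dβ` (`curvature_eq_add`, `exists_difference_eq`). Hence the class of `C` does not depend on
  `σ`, and algebroids with the same class have isotropic sections with the same curvature.
* Isotropic sections exist: local splittings of the anchor glue by a partition of unity, and a
  splitting `τ` becomes isotropic on subtracting `½ ρ^*⟨τ ·, τ ·⟩` (`nonempty_isotropicSection`).

All computations with brackets take place on sections. There `Γ(D)` is a Lie–Rinehart algebra over
`C^∞(M)`, and `Ω^k(D)` consists of the alternating `C^∞(M)`-multilinear forms on `Γ(D)`; in
particular `Ω¹(D)` is the `C^∞(M)`-dual of `Γ(D)`. Such forms are evaluated pointwise by means of cut-off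
functions (`dual_apply_eq_zero`).

The smooth structure of `E` enters in two places. A set-theoretic section of `E` is smooth if its
pairings with all smooth sections are (`contMDiff_of_pairing`), which gives the smoothness of
`ρ^* α` and of modified splittings. The bundle `D ⊕ D^*` is glued from frames of `D` and their dual frames,
and its smooth sections are `Γ(D) ⊕ Ω¹(D)` (`modelSecEquiv`).
-/

noncomputable section

/-! ### The twisted Dorfman bracket over a Lie–Rinehart ring -/

namespace Courant

section Dorfman

theorem swap12 {A L : Type*} [CommRing A] [AddCommGroup L] [Module A L]
    {C : L →ₗ[A] L →ₗ[A] L →ₗ[A] A} (hC : ∀ X Z, C X X Z = 0) (X Y Z : L) :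
    C X Y Z = - C Y X Z := by
  have h := hC (X + Y) Z
  simp only [map_add, LinearMap.add_apply, hC, zero_add, add_zero] at h
  exact eq_neg_of_add_eq_zero_right h

theorem swap23 {A L : Type*} [CommRing A] [AddCommGroup L] [Module A L]
    {C : L →ₗ[A] L →ₗ[A] L →ₗ[A] A} (hC : ∀ X Z, C X Z Z = 0) (X Y Z : L) :
    C X Y Z = - C X Z Y := by
  have h := hC X (Y + Z)
  simp only [map_add, LinearMap.add_apply, hC, zero_add, add_zero] at h
  exact eq_neg_of_add_eq_zero_right h

variable {A L : Type*} [CommRing A] [LieRing L] [Module A L] [LieRingModule L A]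
  [LieRinehartRing A L]

theorem smul_lie_of_lieRinehart (f : A) (X Y : L) : ⁅f • X, Y⁆ = f • ⁅X, Y⁆ - ⁅Y, f⁆ • X := by
  rw [← lie_skew, LieRinehartRing.leibniz_smul_right, ← lie_skew X Y]
  module

/-- The bracket of `(X, α)` and `(Y, β)` in `L ⊕ L^*`, twisted by the `3`-form `C`:
`([X, Y], 𝓛_X β - ι_Y dα + C(X, Y, ·))`. -/
def dorfman (C : L →ₗ[A] L →ₗ[A] L →ₗ[A] A) (a b : L × Module.Dual A L) :
    L × Module.Dual A L :=
  (⁅a.1, b.1⁆,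
    { toFun := fun Z => ⁅a.1, b.2 Z⁆ - b.2 ⁅a.1, Z⁆ - ⁅b.1, a.2 Z⁆ + ⁅Z, a.2 b.1⁆ + a.2 ⁅b.1, Z⁆
        + C a.1 b.1 Z
      map_add' := fun Z W => by
        simp only [map_add, lie_add, add_lie]
        ring
      map_smul' := fun f Z => by
        simp only [map_smul, map_add, smul_eq_mul, LieRinehartRing.leibniz_smul_right,
          LieRinehartRing.leibniz_mul_right, LieRinehartRing.lie_smul_eq_mul, RingHom.id_apply]
        ring })

variable {C : L →ₗ[A] L →ₗ[A] L →ₗ[A] A}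

theorem dorfman_fst (a b : L × Module.Dual A L) : (dorfman C a b).1 = ⁅a.1, b.1⁆ := rfl

theorem dorfman_snd (a b : L × Module.Dual A L) (Z : L) :
    (dorfman C a b).2 Z = ⁅a.1, b.2 Z⁆ - b.2 ⁅a.1, Z⁆ - ⁅b.1, a.2 Z⁆ + ⁅Z, a.2 b.1⁆
      + a.2 ⁅b.1, Z⁆ + C a.1 b.1 Z := rfl

theorem dorfman_add_left (a a' b : L × Module.Dual A L) :
    dorfman C (a + a') b = dorfman C a b + dorfman C a' b := by
  refine Prod.ext ?_ (LinearMap.ext fun Z => ?_)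
  · simp [dorfman_fst]
  · simp only [dorfman_snd, Prod.fst_add, Prod.snd_add, LinearMap.add_apply, add_lie, lie_add,
      map_add]
    ring

theorem dorfman_add_right (a b b' : L × Module.Dual A L) :
    dorfman C a (b + b') = dorfman C a b + dorfman C a b' := by
  refine Prod.ext ?_ (LinearMap.ext fun Z => ?_)
  · simp [dorfman_fst]
  · simp only [dorfman_snd, Prod.fst_add, Prod.snd_add, LinearMap.add_apply, add_lie, lie_add,
      map_add]
    ring

theorem dorfman_smul_right (f : A) (a b : L × Module.Dual A L) :
    dorfman C a (f • b) = ⁅a.1, f⁆ • b + f • dorfman C a b := by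
  refine Prod.ext ?_ (LinearMap.ext fun Z => ?_)
  · simp [dorfman_fst, add_comm]
  · simp only [dorfman_snd, Prod.smul_fst, Prod.smul_snd, Prod.snd_add, LinearMap.add_apply,
      LinearMap.smul_apply, map_smul, smul_eq_mul, LieRinehartRing.leibniz_mul_right,
      LieRinehartRing.lie_smul_eq_mul, smul_lie_of_lieRinehart, map_sub]
    ring

/-- The bracket is linear in its first argument over functions that `L` annihilates. -/
theorem dorfman_smul_left {f : A} (hf : ∀ Z : L, ⁅Z, f⁆ = 0) (a b : L × Module.Dual A L) :
    dorfman C (f • a) b = f • dorfman C a b := by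
  refine Prod.ext ?_ (LinearMap.ext fun Z => ?_)
  · simp [dorfman_fst, smul_lie_of_lieRinehart, hf]
  · simp only [dorfman_snd, Prod.smul_fst, Prod.smul_snd, LinearMap.smul_apply, map_smul,
      smul_eq_mul, LieRinehartRing.leibniz_mul_right, LieRinehartRing.lie_smul_eq_mul,
      smul_lie_of_lieRinehart, hf, map_sub, zero_smul, map_zero]
    ring

theorem dorfman_self_fst (a : L × Module.Dual A L) : (dorfman C a a).1 = 0 := by
  simp [dorfman_fst]

theorem dorfman_self_snd (hC : ∀ X Z, C X X Z = 0) (a : L × Module.Dual A L) (Z : L) :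
    (dorfman C a a).2 Z = ⁅Z, a.2 a.1⁆ := by
  rw [dorfman_snd, hC]; ring

theorem dorfman_invariant (hC : ∀ X Y, C X Y Y = 0) (a b : L × Module.Dual A L) :
    ⁅a.1, b.2 b.1⁆ = (dorfman C a b).2 b.1 + b.2 (dorfman C a b).1 := by
  rw [dorfman_snd, hC, dorfman_fst, lie_self, map_zero]; ring

/-- The Cartan formula for the differential of a `3`-form. -/
def cartan3 (C : L →ₗ[A] L →ₗ[A] L →ₗ[A] A) (X Y Z W : L) : A :=
  ⁅X, C Y Z W⁆ - ⁅Y, C X Z W⁆ + ⁅Z, C X Y W⁆ - ⁅W, C X Y Z⁆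
    - C ⁅X, Y⁆ Z W + C ⁅X, Z⁆ Y W - C ⁅X, W⁆ Y Z - C ⁅Y, Z⁆ X W + C ⁅Y, W⁆ X Z - C ⁅Z, W⁆ X Y

/-- The Cartan formula for the differential of a `2`-form. -/
def cartan2 (β : L →ₗ[A] L →ₗ[A] A) (X Y Z : L) : A :=
  ⁅X, β Y Z⁆ - ⁅Y, β X Z⁆ + ⁅Z, β X Y⁆ - β ⁅X, Y⁆ Z + β ⁅X, Z⁆ Y - β ⁅Y, Z⁆ X

/-- The defect of the Jacobi identity of the twisted bracket is the differential of the twist. -/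
theorem dorfman_jacobiator (h12 : ∀ X Z, C X X Z = 0) (h23 : ∀ X Z, C X Z Z = 0)
    (a b c : L × Module.Dual A L) (W : L) :
    (dorfman C a (dorfman C b c)).2 W - (dorfman C (dorfman C a b) c).2 W
      - (dorfman C b (dorfman C a c)).2 W = cartan3 C a.1 b.1 c.1 W := by
  obtain ⟨X, α⟩ := a
  obtain ⟨Y, β⟩ := b
  obtain ⟨Z, γ⟩ := c
  have cyc : ∀ U V₁ V₂, C U V₁ V₂ = C V₁ V₂ U := fun U V₁ V₂ => by
    rw [swap12 h12, swap23 h23, neg_neg]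
  rw [cartan3, cyc ⁅X, W⁆, cyc ⁅Y, W⁆, cyc ⁅Z, W⁆, swap12 h12 ⁅Y, Z⁆, swap12 h12 ⁅X, Z⁆]
  simp only [dorfman_snd, dorfman_fst, lie_add, lie_sub, map_sub, lie_lie]
  abel

theorem dorfman_jacobi (h12 : ∀ X Z, C X X Z = 0) (h23 : ∀ X Z, C X Z Z = 0)
    (hd : ∀ X Y Z W, cartan3 C X Y Z W = 0) (a b c : L × Module.Dual A L) :
    dorfman C a (dorfman C b c) = dorfman C (dorfman C a b) c + dorfman C b (dorfman C a c) := by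
  refine Prod.ext ?_ (LinearMap.ext fun W => ?_)
  · simp only [dorfman_fst, Prod.fst_add, leibniz_lie a.1 b.1 c.1]
  · rw [Prod.snd_add, LinearMap.add_apply, ← sub_eq_zero, ← sub_sub,
      dorfman_jacobiator h12 h23, hd]

end Dorfman

end Courant

/-! ### Smooth functions and sections as a Lie–Rinehart ring -/

namespace Courant

variable {n : ℕ} {M : Type u} [TopologicalSpace M] [ChartedSpace (EuclideanSpace ℝ (Fin n)) M]

/-- The ring `C^∞(M)`. -/
abbrev SmoothFunction (n : ℕ) (M : Type u) [TopologicalSpace M]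
    [ChartedSpace (EuclideanSpace ℝ (Fin n)) M] : Type u :=
  C^∞⟮𝓡 n, M; 𝓘(ℝ, ℝ), ℝ⟯

theorem add_self_cancel {f g : SmoothFunction n M} (h : f + f = g + g) : f = g :=
  ContMDiffMap.ext fun x => by
    have h3 : f x + f x = g x + g x := congrArg (fun k : SmoothFunction n M => k x) h
    linarith

section SectionModule

variable {F : Type*} [NormedAddCommGroup F] [NormedSpace ℝ F]
  {E : M → Type*} [TopologicalSpace (TotalSpace F E)] [∀ x, TopologicalSpace (E x)]
  [∀ x, AddCommGroup (E x)] [∀ x, Module ℝ (E x)] [FiberBundle F E] [VectorBundle ℝ F E]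

/-- The pointwise product of a function and a section. -/
instance : SMul (SmoothFunction n M) (ContMDiffSection (𝓡 n) F ∞ E) :=
  ⟨fun f s => ⟨fun x => f x • s x, f.contMDiff.smul_section s.contMDiff⟩⟩

instance : Module (SmoothFunction n M) (ContMDiffSection (𝓡 n) F ∞ E) where
  one_smul s := ContMDiffSection.ext fun x => one_smul ℝ (s x)
  mul_smul f g s := ContMDiffSection.ext fun x => mul_smul (f x) (g x) (s x)
  smul_zero f := ContMDiffSection.ext fun x => smul_zero (f x)
  smul_add f s t := ContMDiffSection.ext fun x => smul_add (f x) (s x) (t x)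
  add_smul f g s := ContMDiffSection.ext fun x => add_smul (f x) (g x) (s x)
  zero_smul s := ContMDiffSection.ext fun x => zero_smul ℝ (s x)

theorem algebraMap_smul_section (c : ℝ) (s : ContMDiffSection (𝓡 n) F ∞ E) :
    algebraMap ℝ (SmoothFunction n M) c • s = c • s := rfl

end SectionModule

theorem mdifferentiableAt_smoothFunction (f : SmoothFunction n M) (x : M) :
    MDifferentiableAt (𝓡 n) 𝓘(ℝ, ℝ) f x :=
  f.contMDiff.mdifferentiableAt (by simp)

theorem dirDeriv_add (f g : SmoothFunction n M) (x : M) (w : TangentSpace (𝓡 n) x) :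
    dirDeriv (⇑f + ⇑g) x w = dirDeriv f x w + dirDeriv g x w := by
  rw [dirDeriv, mfderiv_add (mdifferentiableAt_smoothFunction f x)
    (mdifferentiableAt_smoothFunction g x)]
  rfl

theorem dirDeriv_mul (f g : SmoothFunction n M) (x : M) (w : TangentSpace (𝓡 n) x) :
    dirDeriv (⇑f * ⇑g) x w = f x * dirDeriv g x w + g x * dirDeriv f x w := by
  rw [dirDeriv, ((mdifferentiableAt_smoothFunction f x).hasMFDerivAt.mul
    (mdifferentiableAt_smoothFunction g x).hasMFDerivAt).mfderiv]
  rfl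

theorem dirDeriv_tangent_add (f : M → ℝ) (x : M) (w w' : TangentSpace (𝓡 n) x) :
    dirDeriv f x (w + w') = dirDeriv f x w + dirDeriv f x w' :=
  map_add (mfderiv (𝓡 n) 𝓘(ℝ, ℝ) f x) w w'

theorem dirDeriv_tangent_smul (f : M → ℝ) (x : M) (c : ℝ) (w : TangentSpace (𝓡 n) x) :
    dirDeriv f x (c • w) = c * dirDeriv f x w :=
  map_smul (mfderiv (𝓡 n) 𝓘(ℝ, ℝ) f x) c w

theorem dirDeriv_tangent_zero (f : M → ℝ) (x : M) :
    dirDeriv f x (0 : TangentSpace (𝓡 n) x) = 0 :=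
  map_zero (mfderiv (𝓡 n) 𝓘(ℝ, ℝ) f x)

variable [IsManifold (𝓡 n) ∞ M]

/-- The derivative `X f` of a smooth function along a smooth vector field. -/
def lieDeriv (X : SmoothVectorField n M) (f : SmoothFunction n M) : SmoothFunction n M where
  val x := dirDeriv f x (X x)
  property := by
    have h : ContMDiff (𝓡 n).tangent (𝓘(ℝ, ℝ)).tangent ∞ (tangentMap (𝓡 n) 𝓘(ℝ, ℝ) f) :=
      f.contMDiff.contMDiff_tangentMap (by simp)
    have h2 := h.comp X.contMDiff
    have h3 := (contMDiff_snd_tangentBundle_modelSpace ℝ 𝓘(ℝ, ℝ)).comp h2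
    exact h3

instance : LieRing (SmoothVectorField n M) where
  bracket := lieBracket
  add_lie X Y Z := ContMDiffSection.ext fun x =>
    VectorField.mlieBracket_add_left X.mdifferentiableAt Y.mdifferentiableAt
  lie_add X Y Z := ContMDiffSection.ext fun x =>
    VectorField.mlieBracket_add_right Y.mdifferentiableAt Z.mdifferentiableAt
  lie_self X := ContMDiffSection.ext fun x =>
    congrFun VectorField.mlieBracket_self x
  leibniz_lie X Y Z := ContMDiffSection.ext fun x => by
    have h : IsManifold (𝓡 n) (minSmoothness ℝ 3) M := by
      rw [minSmoothness_of_isRCLikeNormedField]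
      infer_instance
    have h2 : ∀ X : SmoothVectorField n M, ContMDiffAt (𝓡 n) (𝓡 n).tangent (minSmoothness ℝ 2)
        (fun x => (⟨x, X x⟩ : TangentBundle (𝓡 n) M)) x := fun X => by
      rw [minSmoothness_of_isRCLikeNormedField]
      exact X.contMDiff.contMDiffAt.of_le (WithTop.coe_le_coe.2 (le_top (a := (2 : ℕ∞))))
    exact VectorField.leibniz_identity_mlieBracket_apply (h2 X) (h2 Y) (h2 Z)

theorem lie_vectorField_smul (X Y : SmoothVectorField n M) (f : SmoothFunction n M) :
    ⁅X, f • Y⁆ = f • ⁅X, Y⁆ + lieDeriv X f • Y := by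
  ext x
  refine (VectorField.mlieBracket_smul_right (mdifferentiableAt_smoothFunction f x)
    Y.mdifferentiableAt).trans (add_comm _ _)

theorem lieDeriv_add (X : SmoothVectorField n M) (f g : SmoothFunction n M) :
    lieDeriv X (f + g) = lieDeriv X f + lieDeriv X g :=
  ContMDiffMap.ext fun x => dirDeriv_add f g x (X x)

theorem lieDeriv_mul (X : SmoothVectorField n M) (f g : SmoothFunction n M) :
    lieDeriv X (f * g) = f * lieDeriv X g + lieDeriv X f * g := by
  ext x
  refine (dirDeriv_mul f g x (X x)).trans ?_
  rw [mul_comm (g x)]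
  rfl

/-- A bracket that satisfies the Leibniz rule and the Jacobi identity has `[X, Y]` act on
functions as the commutator of `X` and `Y`: expand `[[X, Y], f Z]` in two ways. -/
theorem anchor_commutator_of_jacobi {A S : Type*} [CommRing A] [AddCommGroup S] [Module A S]
    (br : S → S → S) (act : S → A → A) (br_add : ∀ a b c, br a (b + c) = br a b + br a c)
    (leibniz : ∀ a b f, br a (f • b) = f • br a b + act a f • b)
    (jacobi : ∀ a b c, br a (br b c) = br (br a b) c + br b (br a c)) (a b c : S) (f : A) :
    (act (br a b) f - (act a (act b f) - act b (act a f))) • c = 0 := by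
  have h := jacobi a b (f • c)
  simp only [leibniz, br_add] at h
  have h' : f • br a (br b c) = f • br (br a b) c + f • br b (br a c) := by
    rw [jacobi, smul_add]
  rw [h'] at h
  have h2 := sub_eq_zero.2 h.symm
  rw [← h2]
  module

/-- The commutator of the Lie derivatives of functions. It follows formally from the Leibniz rule
and the Jacobi identity of vector fields wherever some vector field does not vanish; where `X`, `Y` and
`[X, Y]` all vanish, both sides are zero. -/
theorem lieDeriv_lie (X Y : SmoothVectorField n M) (f : SmoothFunction n M) :
    lieDeriv ⁅X, Y⁆ f = lieDeriv X (lieDeriv Y f) - lieDeriv Y (lieDeriv X f) := by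
  have key : ∀ (Z : SmoothVectorField n M) (x : M), Z x ≠ 0 →
      lieDeriv ⁅X, Y⁆ f x = (lieDeriv X (lieDeriv Y f) - lieDeriv Y (lieDeriv X f)) x := by
    intro Z x hZ
    have h := anchor_commutator_of_jacobi (A := SmoothFunction n M)
      (S := SmoothVectorField n M) (fun X Y => ⁅X, Y⁆) lieDeriv (fun a b c => lie_add a b c)
      (fun a b f => lie_vectorField_smul a b f) (fun a b c => leibniz_lie a b c) X Y Z f
    have h2 := congrArg (fun s : SmoothVectorField n M => s x) h
    exact sub_eq_zero.1 ((smul_eq_zero.1 h2).resolve_right hZ)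
  ext x
  by_cases h1 : X x = 0
  · by_cases h2 : Y x = 0
    · by_cases h3 : ⁅X, Y⁆ x = 0
      · change dirDeriv _ x _ = dirDeriv _ x _ - dirDeriv _ x _
        rw [h1, h2, h3, dirDeriv_tangent_zero, dirDeriv_tangent_zero, dirDeriv_tangent_zero,
          sub_zero]
      · exact key _ x h3
    · exact key _ x h2
  · exact key _ x h1

namespace LieSubalgebroid

variable {D : LieSubalgebroid n M}

@[ext]
theorem sections_ext {X Y : D.Sections} (h : ∀ x, val X x = val Y x) : X = Y :=
  Subtype.ext (ContMDiffSection.ext fun x => congrArg Subtype.val (h x))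

instance : SMul (SmoothFunction n M) D.Sections :=
  ⟨fun f X => ⟨f • X.1, fun x => (D.fiber x).smul_mem (f x) (X.2 x)⟩⟩

instance : Module (SmoothFunction n M) D.Sections :=
  Function.Injective.module (SmoothFunction n M)
    (D.Sections.subtype.toAddMonoidHom) Subtype.val_injective (fun _ _ => rfl)

instance : LieRing D.Sections where
  bracket := bracket
  add_lie X Y Z := Subtype.ext (add_lie X.1 Y.1 Z.1)
  lie_add X Y Z := Subtype.ext (lie_add X.1 Y.1 Z.1)
  lie_self X := Subtype.ext (lie_self X.1)
  leibniz_lie X Y Z := Subtype.ext (leibniz_lie X.1 Y.1 Z.1)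

/-- The sections of `D` act on functions by differentiation. -/
instance : LieRingModule D.Sections (SmoothFunction n M) where
  bracket X f := lieDeriv X.1 f
  add_lie X Y f := ContMDiffMap.ext fun x => dirDeriv_tangent_add f x (X.1 x) (Y.1 x)
  lie_add X f g := lieDeriv_add X.1 f g
  leibniz_lie X Y f := by
    change _ = lieDeriv ⁅X.1, Y.1⁆ f + _
    rw [lieDeriv_lie, sub_add_cancel]

/-- The `C^∞(M)`-module `Γ(D)` is a Lie–Rinehart algebra. -/
instance : LieRinehartRing (SmoothFunction n M) D.Sections where
  lie_smul_eq_mul' f g X := ContMDiffMap.ext fun x => dirDeriv_tangent_smul g x (f x) (X.1 x)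
  leibniz_mul_right' X f g := lieDeriv_mul X.1 f g
  leibniz_smul_right' X Y f := Subtype.ext (lie_vectorField_smul X.1 Y.1 f)

theorem lie_sections_eq (X Y : D.Sections) : ⁅X, Y⁆ = bracket X Y := rfl

theorem lie_function_apply (X : D.Sections) (f : SmoothFunction n M) (x : M) :
    ⁅X, f⁆ x = dirDeriv f x (X.1 x) := rfl

theorem val_smul (f : SmoothFunction n M) (X : D.Sections) (x : M) :
    val (f • X) x = f x • val X x := rfl

theorem val_add (X Y : D.Sections) (x : M) : val (X + Y) x = val X x + val Y x := rfl

end LieSubalgebroid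

end Courant

/-! ### Cut-off functions, dual families and extension of sections -/

namespace Courant

open scoped Topology

variable {n : ℕ} {M : Type u} [TopologicalSpace M] [ChartedSpace (EuclideanSpace ℝ (Fin n)) M]

section Matrix

variable {ι : Type*} [Fintype ι] [DecidableEq ι]

theorem contMDiffAt_matrix_det {G : M → Matrix ι ι ℝ} {x₀ : M}
    (hG : ∀ i j, ContMDiffAt (𝓡 n) 𝓘(ℝ, ℝ) ∞ (fun x => G x i j) x₀) :
    ContMDiffAt (𝓡 n) 𝓘(ℝ, ℝ) ∞ (fun x => (G x).det) x₀ := by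
  simp only [Matrix.det_apply']
  exact contMDiffAt_finsetSum fun σ _ =>
    contMDiffAt_const.mul (contMDiffAt_finsetProd fun i _ => hG _ _)

theorem contMDiffAt_matrix_inv {G : M → Matrix ι ι ℝ} {x₀ : M}
    (hG : ∀ i j, ContMDiffAt (𝓡 n) 𝓘(ℝ, ℝ) ∞ (fun x => G x i j) x₀) (h0 : (G x₀).det ≠ 0)
    (i j : ι) : ContMDiffAt (𝓡 n) 𝓘(ℝ, ℝ) ∞ (fun x => (G x)⁻¹ i j) x₀ := by
  simp only [Matrix.inv_def, Matrix.smul_apply, smul_eq_mul, Ring.inverse_eq_inv',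
    Matrix.adjugate_apply]
  refine ((contMDiffAt_matrix_det hG).inv₀ h0).mul (contMDiffAt_matrix_det fun k l => ?_)
  by_cases hk : k = j
  · subst hk
    simp only [Matrix.updateRow_self]
    exact contMDiffAt_const
  · simp only [Matrix.updateRow_ne hk]
    exact hG k l

end Matrix

theorem contMDiff_cutoff_mul {U : Set M} (hU : IsOpen U) {g : SmoothFunction n M}
    (hg : tsupport g ⊆ U) {c : M → ℝ} (hc : ContMDiffOn (𝓡 n) 𝓘(ℝ, ℝ) ∞ c U) :
    ContMDiff (𝓡 n) 𝓘(ℝ, ℝ) ∞ (fun x => g x * c x) :=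
  contMDiff_of_tsupport fun _ hx => g.contMDiff.contMDiffAt.mul
    (hc.contMDiffAt (hU.mem_nhds (hg (tsupport_mul_subset_left hx))))

section Bundle

variable {F : Type*} [NormedAddCommGroup F] [NormedSpace ℝ F]
  {E : M → Type*} [TopologicalSpace (TotalSpace F E)] [∀ x, TopologicalSpace (E x)]
  [∀ x, AddCommGroup (E x)] [∀ x, Module ℝ (E x)] [FiberBundle F E] [VectorBundle ℝ F E]

variable (F) in
/-- Smooth sections that are independent at a point have a smooth dual family of linear
functionals nearby. -/
theorem exists_dual_functionals [FiniteDimensional ℝ F] {ι : Type*} [Fintype ι] [DecidableEq ι]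
    [ContMDiffVectorBundle ∞ F E (𝓡 n)]
    {s : ι → ∀ x, E x} {U : Set M} (hU : IsOpen U) {x₀ : M} (hx₀ : x₀ ∈ U)
    (hs : ∀ i, ContMDiffOn (𝓡 n) ((𝓡 n).prod 𝓘(ℝ, F)) ∞
      (fun x => (⟨x, s i x⟩ : TotalSpace F E)) U)
    (hli : LinearIndependent ℝ (fun i => s i x₀)) :
    ∃ V ⊆ U, IsOpen V ∧ x₀ ∈ V ∧ ∃ c : ι → ∀ x, E x →ₗ[ℝ] ℝ,
      (∀ x ∈ V, ∀ i j, c j x (s i x) = if i = j then 1 else 0) ∧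
      ∀ (t : ∀ x, E x) (j : ι), ∀ x ∈ V, ContMDiffAt (𝓡 n) ((𝓡 n).prod 𝓘(ℝ, F)) ∞
        (fun x => (⟨x, t x⟩ : TotalSpace F E)) x →
        ContMDiffAt (𝓡 n) 𝓘(ℝ, ℝ) ∞ (fun x => c j x (t x)) x := by
  set e := trivializationAt F E x₀ with he
  have hxe : x₀ ∈ e.baseSet := FiberBundle.mem_baseSet_trivializationAt' x₀
  have hli' : LinearIndependent ℝ (fun i => e.linearMapAt ℝ x₀ (s i x₀)) := by
    refine hli.map' _ (LinearMap.ker_eq_bot.2 ?_)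
    rw [e.linearMapAt_def_of_mem hxe]
    exact (e.linearEquivAt ℝ x₀ hxe).injective
  obtain ⟨ℓ, hℓ⟩ : ∃ ℓ : ι → F →ₗ[ℝ] ℝ,
      ∀ i j, ℓ j (e.linearMapAt ℝ x₀ (s i x₀)) = if i = j then 1 else 0 := by
    obtain ⟨g, hg⟩ := (Fintype.linearCombination ℝ
      (fun i => e.linearMapAt ℝ x₀ (s i x₀))).exists_leftInverse_of_injective
        (LinearMap.ker_eq_bot.2 hli'.fintypeLinearCombination_injective)
    refine ⟨fun j => LinearMap.proj j ∘ₗ g, fun i j => ?_⟩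
    have h := LinearMap.congr_fun hg (Pi.single i 1)
    simp only [LinearMap.comp_apply, Fintype.linearCombination_apply_single, one_smul,
      LinearMap.id_apply] at h
    simp only [LinearMap.comp_apply, h, LinearMap.proj_apply, Pi.single_apply, eq_comm]
  have hsm : ∀ (t : ∀ x, E x) (j : ι), ∀ x ∈ e.baseSet,
      ContMDiffAt (𝓡 n) ((𝓡 n).prod 𝓘(ℝ, F)) ∞ (fun x => (⟨x, t x⟩ : TotalSpace F E)) x →
      ContMDiffAt (𝓡 n) 𝓘(ℝ, ℝ) ∞ (fun x => ℓ j (e.linearMapAt ℝ x (t x))) x := by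
    intro t j x hx ht
    have h1 := (e.contMDiffAt_section_iff (IB := 𝓡 n) (n := ∞) (s := t) hx).1 ht
    have h2 : ContMDiffAt 𝓘(ℝ, F) 𝓘(ℝ, ℝ) ∞ (LinearMap.toContinuousLinearMap (ℓ j))
        (e ⟨x, t x⟩).2 :=
      (LinearMap.toContinuousLinearMap (ℓ j)).contMDiff.contMDiffAt
    refine (h2.comp x h1).congr_of_eventuallyEq ?_
    filter_upwards [e.open_baseSet.mem_nhds hx] with y hy
    simp [e.coe_linearMapAt_of_mem hy]
  -- `ℓ` is dual to the sections at `x₀`; near `x₀` it is corrected by the inverse of `G`.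
  let G : M → Matrix ι ι ℝ := fun x => Matrix.of fun k i => ℓ k (e.linearMapAt ℝ x (s i x))
  have hG : ∀ x ∈ U ∩ e.baseSet, ∀ i j,
      ContMDiffAt (𝓡 n) 𝓘(ℝ, ℝ) ∞ (fun x => G x i j) x := fun x hx i j =>
    hsm (s j) i x hx.2 ((hs j).contMDiffAt (hU.mem_nhds hx.1))
  have hG0 : G x₀ = 1 := by
    ext k i
    simp [G, hℓ, Matrix.one_apply, eq_comm]
  have hdet : ∀ᶠ x in 𝓝 x₀, (G x).det ≠ 0 :=
    (contMDiffAt_matrix_det (hG x₀ ⟨hx₀, hxe⟩)).continuousAt.eventually_ne (by simp [hG0])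
  obtain ⟨V, hV, hVo, hxV⟩ := eventually_nhds_iff.1
    (hdet.and ((hU.inter e.open_baseSet).mem_nhds ⟨hx₀, hxe⟩))
  refine ⟨V, fun x hx => (hV x hx).2.1, hVo, hxV,
    fun j x => ∑ k, (G x)⁻¹ j k • (ℓ k ∘ₗ e.linearMapAt ℝ x), fun x hx i j => ?_,
    fun t j x hx ht => ?_⟩
  · have h1 : (G x)⁻¹ * G x = 1 := Matrix.nonsing_inv_mul _ (isUnit_iff_ne_zero.2 (hV x hx).1)
    have h2 := congrFun (congrFun h1 j) i
    rw [Matrix.mul_apply, Matrix.one_apply] at h2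
    simp only [LinearMap.sum_apply, LinearMap.smul_apply, LinearMap.comp_apply, smul_eq_mul]
    simp only [eq_comm (a := i)]
    exact h2
  · simp only [LinearMap.sum_apply, LinearMap.smul_apply, LinearMap.comp_apply, smul_eq_mul]
    exact contMDiffAt_finsetSum fun k _ =>
      (contMDiffAt_matrix_inv (hG x (hV x hx).2) (hV x hx).1 j k).mul (hsm t k x (hV x hx).2.2 ht)

variable [T2Space M] [IsManifold (𝓡 n) ∞ M]

/-- A smooth cut-off function at a point. -/
theorem exists_cutoff {U : Set M} (hU : IsOpen U) {x₀ : M} (hx₀ : x₀ ∈ U) :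
    ∃ g : SmoothFunction n M, (∀ᶠ x in 𝓝 x₀, g x = 1) ∧ tsupport g ⊆ U := by
  obtain ⟨f, -, hf⟩ := (SmoothBumpFunction.nhds_basis_tsupport (I := 𝓡 n) x₀).mem_iff.1
    (hU.mem_nhds hx₀)
  exact ⟨⟨f, f.contMDiff⟩, f.eventuallyEq_one, hf⟩

/-- A section that is smooth near a point agrees near that point with a global one. -/
theorem exists_global_section {U : Set M} (hU : IsOpen U) {x₀ : M} (hx₀ : x₀ ∈ U) {t : ∀ x, E x}
    (ht : ContMDiffOn (𝓡 n) ((𝓡 n).prod 𝓘(ℝ, F)) ∞ (fun x => (⟨x, t x⟩ : TotalSpace F E)) U) :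
    ∃ (g : SmoothFunction n M) (s : ContMDiffSection (𝓡 n) F ∞ E), (∀ᶠ x in 𝓝 x₀, g x = 1) ∧
      tsupport g ⊆ U ∧ ∀ x, s x = g x • t x := by
  obtain ⟨g, hg1, hg2⟩ := exists_cutoff (n := n) hU hx₀
  exact ⟨g, ⟨_, ContMDiffOn.smul_section_of_tsupport g.contMDiff.contMDiffOn hU hg2 ht⟩, hg1, hg2,
    fun _ => rfl⟩

theorem exists_section_apply_eq [FiniteDimensional ℝ F] [ContMDiffVectorBundle ∞ F E (𝓡 n)]
    (x₀ : M) (v : E x₀) : ∃ s : ContMDiffSection (𝓡 n) F ∞ E, s x₀ = v := by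
  obtain ⟨W, hW, hs⟩ := FiberBundle.exists_contMDiffOn_extend (𝓡 n) F (k := ∞) v
  obtain ⟨U, hUW, hU, hxU⟩ := mem_nhds_iff.1 hW
  obtain ⟨g, s, hg, -, hs⟩ := exists_global_section hU hxU (hs.mono hUW)
  refine ⟨s, ?_⟩
  rw [hs, hg.self_of_nhds, one_smul, FiberBundle.extend_apply_self]

/-- The derivatives of the smooth functions separate tangent vectors. -/
theorem tangent_ext {x : M} {v w : TangentSpace (𝓡 n) x}
    (h : ∀ f : SmoothFunction n M, dirDeriv f x v = dirDeriv f x w) : v = w := by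
  let φ := chartAt (EuclideanSpace ℝ (Fin n)) x
  have hinj : Function.Injective (mfderiv (𝓡 n) 𝓘(ℝ, EuclideanSpace ℝ (Fin n))
      (extChartAt (𝓡 n) x) x) :=
    (isInvertible_mfderiv_extChartAt (mem_extChartAt_source x)).injective
  refine hinj (PiLp.ext fun i => ?_)
  let p : EuclideanSpace ℝ (Fin n) →L[ℝ] ℝ := EuclideanSpace.proj i
  have hc : ContMDiffOn (𝓡 n) 𝓘(ℝ, ℝ) ∞ (p ∘ extChartAt (𝓡 n) x) φ.source :=
    p.contMDiff.comp_contMDiffOn contMDiffOn_extChartAt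
  obtain ⟨g, hg, hgU⟩ := exists_cutoff (n := n) φ.open_source (mem_chart_source _ x)
  let f : SmoothFunction n M := ⟨_, contMDiff_cutoff_mul φ.open_source hgU hc⟩
  have hf : ∀ y, f y = g y * (p ∘ extChartAt (𝓡 n) x) y := fun _ => rfl
  have hev : (f : M → ℝ) =ᶠ[𝓝 x] p ∘ extChartAt (𝓡 n) x := by
    filter_upwards [hg] with y hy
    rw [hf, hy, one_mul]
  -- Near `x`, the function `f` is a coordinate function of the chart.
  have key : ∀ u : TangentSpace (𝓡 n) x, dirDeriv f x u =
      p (mfderiv (𝓡 n) 𝓘(ℝ, EuclideanSpace ℝ (Fin n)) (extChartAt (𝓡 n) x) x u) := by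
    intro u
    rw [dirDeriv, hev.mfderiv_eq, mfderiv_comp x 
      (p.contMDiff.contMDiffAt.mdifferentiableAt (n := 1) one_ne_zero)
      (mdifferentiableAt_extChartAt (mem_chart_source _ x)), p.mfderiv_eq]
    rfl
  have := h f
  rw [key, key] at this
  exact this

end Bundle

end Courant

/-! ### Frames and one-forms of a Lie subalgebroid -/

namespace Courant

open scoped Topology

variable {n : ℕ} {M : Type u} [TopologicalSpace M] [ChartedSpace (EuclideanSpace ℝ (Fin n)) M]
  [IsManifold (𝓡 n) ∞ M]

instance (x : M) : FiniteDimensional ℝ (TangentSpace (𝓡 n) x) :=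
  inferInstanceAs (FiniteDimensional ℝ (EuclideanSpace ℝ (Fin n)))

namespace LieSubalgebroid

variable (D : LieSubalgebroid n M)

theorem exists_finrank_fiber : ∃ r : ℕ, ∀ x, Module.finrank ℝ (D.fiber x) = r := by
  obtain ⟨r, hr⟩ := D.subbundle
  refine ⟨r, fun x => ?_⟩
  obtain ⟨U, -, hx, e, -, he⟩ := hr x
  rw [← (he x hx).2, finrank_span_eq_card (he x hx).1, Fintype.card_fin]

/-- The rank of `D`. -/
def rank : ℕ := D.exists_finrank_fiber.choose

theorem finrank_fiber (x : M) : Module.finrank ℝ (D.fiber x) = D.rank :=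
  D.exists_finrank_fiber.choose_spec x

variable {D}

theorem const_smul_sections (c : ℝ) (X : D.Sections) :
    algebraMap ℝ (SmoothFunction n M) c • X = c • X := rfl

theorem sum_val {ι : Type*} (t : Finset ι) (X : ι → D.Sections) (x : M) :
    val (∑ i ∈ t, X i) x = ∑ i ∈ t, val (X i) x := by
  classical
  induction t using Finset.induction_on with
  | empty => rfl
  | insert i t hi h => rw [Finset.sum_insert hi, Finset.sum_insert hi, ← h]; rfl

variable (D) in
/-- Evaluation of sections at a point. -/
def evalAt (x : M) : D.Sections →ₗ[ℝ] D.fiber x where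
  toFun X := val X x
  map_add' _ _ := rfl
  map_smul' _ _ := rfl

theorem evalAt_surjective [T2Space M] (x₀ : M) : Function.Surjective (D.evalAt x₀) := by
  rintro ⟨v, hv⟩
  obtain ⟨r, hr⟩ := D.subbundle
  obtain ⟨U, hU, hx₀, e, hes, he⟩ := hr x₀
  rw [← (he x₀ hx₀).2] at hv
  obtain ⟨a, ha⟩ := (Submodule.mem_span_range_iff_exists_fun ℝ).1 hv
  obtain ⟨g, s, hg, hgU, hs⟩ := exists_global_section (F := EuclideanSpace ℝ (Fin n)) hU hx₀
    (t := fun x => ∑ i, a i • e i x)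
    (ContMDiffOn.sum_section fun i _ => (hes i).const_smul_section (a := a i))
  refine ⟨⟨s, fun x => ?_⟩, Subtype.ext ?_⟩
  · rw [hs]
    by_cases hx : x ∈ U
    · rw [← (he x hx).2]
      exact Submodule.smul_mem _ _ (Submodule.sum_mem _ fun i _ =>
        Submodule.smul_mem _ _ (Submodule.subset_span ⟨i, rfl⟩))
    · rw [image_eq_zero_of_notMem_tsupport fun h => hx (hgU h), zero_smul]
      exact zero_mem _
  · change s x₀ = v
    rw [hs, hg.self_of_nhds, one_smul, ha]

variable (D) in
/-- A linear choice of sections of `D` with given values at a point. -/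
def extend [T2Space M] (x : M) : D.fiber x →ₗ[ℝ] D.Sections :=
  ((D.evalAt x).exists_rightInverse_of_surjective
    (LinearMap.range_eq_top.2 (evalAt_surjective x))).choose

theorem val_extend [T2Space M] (x : M) (v : D.fiber x) : val (D.extend x v) x = v :=
  LinearMap.congr_fun ((D.evalAt x).exists_rightInverse_of_surjective
    (LinearMap.range_eq_top.2 (evalAt_surjective x))).choose_spec v

variable (D) in
/-- A frame of `D` over an open set, made of global sections, with its coefficient functionals. -/
structure LocalFrame (ι : Type*) [Fintype ι] [DecidableEq ι] where
  /-- The domain. -/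
  U : Set M
  isOpen : IsOpen U
  /-- The sections. -/
  e : ι → D.Sections
  /-- The coefficients. -/
  coeff : ι → ∀ x, D.fiber x →ₗ[ℝ] ℝ
  coeff_e : ∀ x ∈ U, ∀ i j, coeff j x (val (e i) x) = if i = j then 1 else 0
  sum_coeff : ∀ x ∈ U, ∀ v, ∑ j, coeff j x v • val (e j) x = v
  smooth : ∀ (X : D.Sections) (j : ι), ContMDiffOn (𝓡 n) 𝓘(ℝ, ℝ) ∞ (fun x => coeff j x (val X x)) U

/-- Sections of `D` that are a basis at one point form a frame nearby. -/
theorem exists_localFrame {ι : Type*} [Fintype ι] [DecidableEq ι] (hι : Fintype.card ι = D.rank)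
    (e : ι → D.Sections) (x₀ : M) (hli : LinearIndependent ℝ (fun i => val (e i) x₀)) :
    ∃ Φ : D.LocalFrame ι, Φ.e = e ∧ x₀ ∈ Φ.U := by
  obtain ⟨V, -, hV, hxV, c, hc, hcs⟩ := exists_dual_functionals (n := n)
    (EuclideanSpace ℝ (Fin n)) (s := fun i x => (e i).1 x) isOpen_univ (Set.mem_univ x₀)
    (fun i => (e i).1.contMDiff.contMDiffOn)
    (hli.map' (D.fiber x₀).subtype (Submodule.ker_subtype _))
  have hdual : ∀ x ∈ V, ∀ i j, (c j x ∘ₗ (D.fiber x).subtype) (val (e i) x) =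
      if i = j then 1 else 0 := fun x hx i j => hc x hx i j
  refine ⟨⟨V, hV, e, fun j x => c j x ∘ₗ (D.fiber x).subtype, hdual, fun x hx v => ?_,
    fun X j x hx => (hcs _ j x hx X.1.contMDiff.contMDiffAt).contMDiffWithinAt⟩, rfl, hxV⟩
  have hli : LinearIndependent ℝ (fun i => val (e i) x) := by
    refine Fintype.linearIndependent_iff.2 fun a ha j => ?_
    have := congrArg (c j x ∘ₗ (D.fiber x).subtype) ha
    rw [map_sum, map_zero] at this
    simpa [map_smul, hdual x hx] using this
  have hspan := hli.span_eq_top_of_card_eq_finrank' (hι.trans (D.finrank_fiber x).symm)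
  obtain ⟨a, rfl⟩ := (Submodule.mem_span_range_iff_exists_fun ℝ).1
    (hspan ▸ Submodule.mem_top : v ∈ Submodule.span ℝ (Set.range fun i => val (e i) x))
  simp only [map_sum, map_smul, hdual x hx]
  simp

/-- A family of functionals on the fibres with smooth values on smooth sections. -/
def mkDual (ξ : ∀ x, D.fiber x →ₗ[ℝ] ℝ)
    (hξ : ∀ X : D.Sections, ContMDiff (𝓡 n) 𝓘(ℝ, ℝ) ∞ (fun x => ξ x (val X x))) :
    Module.Dual (SmoothFunction n M) D.Sections where
  toFun X := ⟨fun x => ξ x (val X x), hξ X⟩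
  map_add' X Y := ContMDiffMap.ext fun x => map_add (ξ x) (val X x) (val Y x)
  map_smul' f X := ContMDiffMap.ext fun x => map_smul (ξ x) (f x) (val X x)

theorem mkDual_apply (ξ : ∀ x, D.fiber x →ₗ[ℝ] ℝ) (hξ) (X : D.Sections) (x : M) :
    mkDual ξ hξ X x = ξ x (val X x) := rfl

variable [T2Space M]

theorem exists_localFrame_at {ι : Type*} [Fintype ι] [DecidableEq ι]
    (hι : Fintype.card ι = D.rank) (x₀ : M) : ∃ Φ : D.LocalFrame ι, x₀ ∈ Φ.U := by
  let b := (Module.finBasis ℝ (D.fiber x₀)).reindex (Fintype.equivOfCardEq (β := ι)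
    ((Fintype.card_fin _).trans ((D.finrank_fiber x₀).trans hι.symm)))
  obtain ⟨Φ, -, h⟩ := exists_localFrame hι (fun i => D.extend x₀ (b i)) x₀ (by
    simpa only [val_extend] using b.linearIndependent)
  exact ⟨Φ, h⟩

/-- Linear functionals on sections over `C^∞(M)` are local and pointwise. -/
theorem dual_apply_eq_zero (α : Module.Dual (SmoothFunction n M) D.Sections) {X : D.Sections}
    {x₀ : M} (hX : val X x₀ = 0) : α X x₀ = 0 := by
  obtain ⟨Φ, hΦ⟩ := exists_localFrame_at (D := D) (Fintype.card_fin _) x₀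
  obtain ⟨g, hg, hgU⟩ := exists_cutoff (n := n) Φ.isOpen hΦ
  let f : Fin D.rank → SmoothFunction n M := fun j =>
    ⟨_, contMDiff_cutoff_mul Φ.isOpen hgU (Φ.smooth X j)⟩
  have hf : ∀ j x, f j x = g x * Φ.coeff j x (val X x) := fun _ _ => rfl
  -- At `x₀` the first summand vanishes since `g x₀ = 1`, the second one since `X` does.
  have hdec : X = (1 - g) • X + ∑ j, f j • Φ.e j := by
    ext1 x
    rw [val_add, sum_val]
    simp only [val_smul, hf, mul_smul, ← Finset.smul_sum]
    by_cases hx : x ∈ Φ.U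
    · rw [Φ.sum_coeff x hx, ← add_smul]
      change _ = (1 - g x + g x) • val X x
      rw [sub_add_cancel, one_smul]
    · have : g x = 0 := image_eq_zero_of_notMem_tsupport fun h => hx (hgU h)
      rw [this, zero_smul, add_zero]
      change _ = (1 - g x) • val X x
      rw [this, sub_zero, one_smul]
  have hα : α X x₀ = (1 - g x₀) * α X x₀ + ∑ j, f j x₀ * α (Φ.e j) x₀ := by
    have h := congrArg (fun Y => ContMDiffMap.evalRingHom (𝕜 := ℝ) (n := ∞) x₀ (α Y)) hdec
    simp only [map_add, map_sum, map_smul, smul_eq_mul, map_mul] at h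
    exact h
  rw [hα, hg.self_of_nhds, sub_self, zero_mul, zero_add]
  exact Finset.sum_eq_zero fun j _ => by rw [hf, hX, map_zero, mul_zero, zero_mul]

theorem dual_apply_congr (α : Module.Dual (SmoothFunction n M) D.Sections) {X Y : D.Sections}
    {x₀ : M} (h : val X x₀ = val Y x₀) : α X x₀ = α Y x₀ := by
  have h' : val (X - Y) x₀ = 0 := by
    change val X x₀ - val Y x₀ = 0
    rw [h, sub_self]
  have := dual_apply_eq_zero α h'
  rw [map_sub] at this
  exact sub_eq_zero.1 this

/-- The value at a point of a `1`-form on `D`, given as a functional on sections. -/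
def dualAt (α : Module.Dual (SmoothFunction n M) D.Sections) (x : M) : D.fiber x →ₗ[ℝ] ℝ where
  toFun v := α (D.extend x v) x
  map_add' v w := by rw [map_add, map_add]; rfl
  map_smul' c v := by
    rw [map_smul, ← const_smul_sections, map_smul]
    rfl

theorem dualAt_val (α : Module.Dual (SmoothFunction n M) D.Sections) (X : D.Sections) (x : M) :
    dualAt α x (val X x) = α X x :=
  dual_apply_congr α (val_extend x _)

theorem dualAt_mkDual (ξ : ∀ x, D.fiber x →ₗ[ℝ] ℝ) (hξ) (x : M) : dualAt (mkDual ξ hξ) x = ξ x :=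
  LinearMap.ext fun v => by
    change ξ x (val (D.extend x v) x) = ξ x v
    rw [val_extend]

end LieSubalgebroid

end Courant

/-! ### Two- and three-forms as multilinear maps on sections -/

namespace Courant

open scoped Topology

/-- A trilinear map from its values. -/
def mkTrilinear {A L : Type*} [CommRing A] [AddCommGroup L] [Module A L] (f : L → L → L → A)
    (add₁ : ∀ X X' Y Z, f (X + X') Y Z = f X Y Z + f X' Y Z)
    (smul₁ : ∀ (a : A) X Y Z, f (a • X) Y Z = a * f X Y Z)
    (add₂ : ∀ X Y Y' Z, f X (Y + Y') Z = f X Y Z + f X Y' Z)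
    (smul₂ : ∀ (a : A) X Y Z, f X (a • Y) Z = a * f X Y Z)
    (add₃ : ∀ X Y Z Z', f X Y (Z + Z') = f X Y Z + f X Y Z')
    (smul₃ : ∀ (a : A) X Y Z, f X Y (a • Z) = a * f X Y Z) : L →ₗ[A] L →ₗ[A] L →ₗ[A] A :=
  LinearMap.mk₂ A
    (fun X Y => { toFun := f X Y, map_add' := add₃ X Y, map_smul' := fun a Z => smul₃ a X Y Z })
    (fun X X' Y => LinearMap.ext fun Z => add₁ X X' Y Z)
    (fun a X Y => LinearMap.ext fun Z => smul₁ a X Y Z)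
    (fun X Y Y' => LinearMap.ext fun Z => add₂ X Y Y' Z)
    (fun a X Y => LinearMap.ext fun Z => smul₂ a X Y Z)

namespace LieSubalgebroid

variable {n : ℕ} {M : Type u} [TopologicalSpace M] [ChartedSpace (EuclideanSpace ℝ (Fin n)) M]
  [IsManifold (𝓡 n) ∞ M] {D : LieSubalgebroid n M}

theorem eval_cons {k : ℕ} (θ : D.Form (k + 1)) (X : D.Sections) (Y : Fin k → D.Sections) (x : M) :
    eval θ (Matrix.vecCons X Y) x = (θ.1 x).curryLeft (val X x) (fun i => val (Y i) x) := by
  rw [eval, AlternatingMap.curryLeft_apply_apply]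
  congr 1
  ext1 i
  refine Fin.cases rfl (fun _ => rfl) i

theorem eval_three (θ : D.Form 3) (X Y Z : D.Sections) (x : M) :
    eval θ ![X, Y, Z] x = (((θ.1 x).curryLeft (val X x)).curryLeft (val Y x)).curryLeft (val Z x)
      (fun i => i.elim0) := by
  rw [eval_cons]
  simp only [AlternatingMap.curryLeft_apply_apply]
  congr 2
  ext1 i
  refine Fin.cases rfl (fun i => Fin.cases rfl (fun i => i.elim0) i) i

theorem eval_two (θ : D.Form 2) (X Y : D.Sections) (x : M) :
    eval θ ![X, Y] x = ((θ.1 x).curryLeft (val X x)).curryLeft (val Y x) (fun i => i.elim0) := by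
  rw [eval_cons]
  simp only [AlternatingMap.curryLeft_apply_apply]
  congr 2
  ext1 i
  refine Fin.cases rfl (fun i => i.elim0) i

theorem eval_eq_zero {k : ℕ} (θ : D.Form k) (X : Fin k → D.Sections) (x : M) (i j : Fin k)
    (hij : i ≠ j) (h : X i = X j) : eval θ X x = 0 :=
  (θ.1 x).map_eq_zero_of_eq _ (by rw [h]) hij

/-- A `3`-form on `D` as a trilinear form on sections. -/
def trilinear (θ : D.Form 3) : D.Sections →ₗ[SmoothFunction n M] D.Sections →ₗ[SmoothFunction n M]
    D.Sections →ₗ[SmoothFunction n M] SmoothFunction n M :=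
  mkTrilinear (fun X Y Z => ⟨eval θ ![X, Y, Z], θ.2 _⟩)
    (fun X X' Y Z => ContMDiffMap.ext fun x => by
      change eval θ _ x = eval θ _ x + eval θ _ x
      simp only [eval_three, val_add, map_add, AlternatingMap.curryLeft_add,
        AlternatingMap.add_apply, LinearMap.add_apply])
    (fun a X Y Z => ContMDiffMap.ext fun x => by
      change eval θ _ x = a x * eval θ _ x
      simp only [eval_three, val_smul, map_smul, AlternatingMap.curryLeft_smul,
        AlternatingMap.smul_apply, LinearMap.smul_apply, smul_eq_mul])
    (fun X Y Y' Z => ContMDiffMap.ext fun x => by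
      change eval θ _ x = eval θ _ x + eval θ _ x
      simp only [eval_three, val_add, map_add, AlternatingMap.curryLeft_add,
        AlternatingMap.add_apply, LinearMap.add_apply])
    (fun a X Y Z => ContMDiffMap.ext fun x => by
      change eval θ _ x = a x * eval θ _ x
      simp only [eval_three, val_smul, map_smul, AlternatingMap.curryLeft_smul,
        AlternatingMap.smul_apply, LinearMap.smul_apply, smul_eq_mul])
    (fun X Y Z Z' => ContMDiffMap.ext fun x => by
      change eval θ _ x = eval θ _ x + eval θ _ x
      simp only [eval_three, val_add, map_add, AlternatingMap.add_apply])
    (fun a X Y Z => ContMDiffMap.ext fun x => by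
      change eval θ _ x = a x * eval θ _ x
      simp only [eval_three, val_smul, map_smul, AlternatingMap.smul_apply, smul_eq_mul])

theorem trilinear_apply (θ : D.Form 3) (X Y Z : D.Sections) (x : M) :
    trilinear θ X Y Z x = eval θ ![X, Y, Z] x := rfl

theorem trilinear_self_left (θ : D.Form 3) (X Z : D.Sections) : trilinear θ X X Z = 0 :=
  ContMDiffMap.ext fun x => eval_eq_zero θ ![X, X, Z] x 0 1 (by decide) rfl

theorem trilinear_self_right (θ : D.Form 3) (X Z : D.Sections) : trilinear θ X Z Z = 0 :=
  ContMDiffMap.ext fun x => eval_eq_zero θ ![X, Z, Z] x 1 2 (by decide) rfl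

/-- A `2`-form on `D` as a bilinear form on sections. -/
def bilinear (β : D.Form 2) : D.Sections →ₗ[SmoothFunction n M] D.Sections →ₗ[SmoothFunction n M]
    SmoothFunction n M :=
  LinearMap.mk₂ _ (fun X Y => ⟨eval β ![X, Y], β.2 _⟩)
    (fun X X' Y => ContMDiffMap.ext fun x => by
      change eval β _ x = eval β _ x + eval β _ x
      simp only [eval_two, val_add, map_add, AlternatingMap.curryLeft_add,
        AlternatingMap.add_apply, LinearMap.add_apply])
    (fun a X Y => ContMDiffMap.ext fun x => by
      change eval β _ x = a x * eval β _ x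
      simp only [eval_two, val_smul, map_smul, AlternatingMap.curryLeft_smul,
        AlternatingMap.smul_apply, LinearMap.smul_apply, smul_eq_mul])
    (fun X Y Y' => ContMDiffMap.ext fun x => by
      change eval β _ x = eval β _ x + eval β _ x
      simp only [eval_two, val_add, map_add, AlternatingMap.add_apply])
    (fun a X Y => ContMDiffMap.ext fun x => by
      change eval β _ x = a x * eval β _ x
      simp only [eval_two, val_smul, map_smul, AlternatingMap.smul_apply, smul_eq_mul])

theorem bilinear_self (β : D.Form 2) (X : D.Sections) : bilinear β X X = 0 :=
  ContMDiffMap.ext fun x => eval_eq_zero β ![X, X] x 0 1 (by decide) rfl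

theorem d_two (β : D.Form 2) (X Y Z : D.Sections) (x : M) :
    d β ![X, Y, Z] x = cartan2 (bilinear β) X Y Z x := by
  have hd : ∀ X Y Z : D.Sections, ⁅X, bilinear β Y Z⁆ x = dirDeriv (eval β ![Y, Z]) x (X.1 x) :=
    fun _ _ _ => rfl
  have e0 : Fin.removeNth 0 ![X, Y, Z] = ![Y, Z] := by ext1 i; fin_cases i <;> rfl
  have e1 : Fin.removeNth 1 ![X, Y, Z] = ![X, Z] := by ext1 i; fin_cases i <;> rfl
  have e2 : Fin.removeNth 2 ![X, Y, Z] = ![X, Y] := by ext1 i; fin_cases i <;> rfl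
  have f0 : ∀ U V : D.Sections, Fin.removeNth 0 ![U, V] = ![V] := by
    intro U V; ext1 i; fin_cases i; rfl
  have f1 : ∀ U V : D.Sections, Fin.removeNth 1 ![U, V] = ![U] := by
    intro U V; ext1 i; fin_cases i; rfl
  have h0 : (Finset.univ.filter fun j : Fin 2 => 0 ≤ j) = {0, 1} := by decide
  have h1 : (Finset.univ.filter fun j : Fin 2 => 1 ≤ j) = {1} := by decide
  have c0 : (0 : Fin 2).castSucc = (0 : Fin 3) := rfl
  have c1 : (1 : Fin 2).castSucc = (1 : Fin 3) := rfl
  have s0 : (0 : Fin 2).succ = (1 : Fin 3) := rfl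
  have s1 : (1 : Fin 2).succ = (2 : Fin 3) := rfl
  rw [d, Fin.sum_univ_three, Fin.sum_univ_two, h0, h1, Finset.sum_singleton,
    Finset.sum_pair (by decide), c0, c1, s0, s1, e0, e1, e2, f0, f1, f1]
  change _ = ⁅X, bilinear β Y Z⁆ x - ⁅Y, bilinear β X Z⁆ x + ⁅Z, bilinear β X Y⁆ x
    - eval β ![⁅X, Y⁆, Z] x + eval β ![⁅X, Z⁆, Y] x - eval β ![⁅Y, Z⁆, X] x
  rw [hd, hd, hd]
  simp [lie_sections_eq]
  ring

theorem d_three (θ : D.Form 3) (X Y Z W : D.Sections) (x : M) :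
    d θ ![X, Y, Z, W] x = cartan3 (trilinear θ) X Y Z W x := by
  have hd : ∀ X Y Z W : D.Sections,
    ⁅X, trilinear θ Y Z W⁆ x = dirDeriv (eval θ ![Y, Z, W]) x (X.1 x) := fun _ _ _ _ => rfl
  have e0 : Fin.removeNth 0 ![X, Y, Z, W] = ![Y, Z, W] := by ext1 i; fin_cases i <;> rfl
  have e1 : Fin.removeNth 1 ![X, Y, Z, W] = ![X, Z, W] := by ext1 i; fin_cases i <;> rfl
  have e2 : Fin.removeNth 2 ![X, Y, Z, W] = ![X, Y, W] := by ext1 i; fin_cases i <;> rfl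
  have e3 : Fin.removeNth 3 ![X, Y, Z, W] = ![X, Y, Z] := by ext1 i; fin_cases i <;> rfl
  have f0 : ∀ U V T : D.Sections, Fin.removeNth 0 ![U, V, T] = ![V, T] := by
    intro U V T; ext1 i; fin_cases i <;> rfl
  have f1 : ∀ U V T : D.Sections, Fin.removeNth 1 ![U, V, T] = ![U, T] := by
    intro U V T; ext1 i; fin_cases i <;> rfl
  have f2 : ∀ U V T : D.Sections, Fin.removeNth 2 ![U, V, T] = ![U, V] := by
    intro U V T; ext1 i; fin_cases i <;> rfl
  have h0 : (Finset.univ.filter fun j : Fin 3 => 0 ≤ j) = {0, 1, 2} := by decide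
  have h1 : (Finset.univ.filter fun j : Fin 3 => 1 ≤ j) = {1, 2} := by decide
  have h2 : (Finset.univ.filter fun j : Fin 3 => 2 ≤ j) = {2} := by decide
  have c0 : (0 : Fin 3).castSucc = (0 : Fin 4) := rfl
  have c1 : (1 : Fin 3).castSucc = (1 : Fin 4) := rfl
  have c2 : (2 : Fin 3).castSucc = (2 : Fin 4) := rfl
  have s0 : (0 : Fin 3).succ = (1 : Fin 4) := rfl
  have s1 : (1 : Fin 3).succ = (2 : Fin 4) := rfl
  have s2 : (2 : Fin 3).succ = (3 : Fin 4) := rfl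
  have S0 : ∀ f : Fin 3 → ℝ, ∑ j ∈ {0, 1, 2}, f j = f 0 + (f 1 + f 2) := fun f => by
    rw [Finset.sum_insert (by decide), Finset.sum_pair (by decide)]
  have S1 : ∀ f : Fin 3 → ℝ, ∑ j ∈ {1, 2}, f j = f 1 + f 2 := fun f =>
    Finset.sum_pair (by decide)
  rw [d, Fin.sum_univ_four, Fin.sum_univ_three, h0, h1, h2, Finset.sum_singleton, S0, S1]
  simp only [c0, c1, c2, s0, s1, s2, e0, e1, e2, e3]
  simp only [f0, f1, f2]
  change _ = ⁅X, trilinear θ Y Z W⁆ x - ⁅Y, trilinear θ X Z W⁆ x + ⁅Z, trilinear θ X Y W⁆ x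
    - ⁅W, trilinear θ X Y Z⁆ x - eval θ ![⁅X, Y⁆, Z, W] x + eval θ ![⁅X, Z⁆, Y, W] x
    - eval θ ![⁅X, W⁆, Y, Z] x - eval θ ![⁅Y, Z⁆, X, W] x + eval θ ![⁅Y, W⁆, X, Z] x
    - eval θ ![⁅Z, W⁆, X, Y] x
  rw [hd, hd, hd, hd]
  simp [lie_sections_eq]
  ring

theorem mem_Z3_iff (θ : D.Form 3) :
    θ ∈ D.Z3 ↔ ∀ X Y Z W, cartan3 (trilinear θ) X Y Z W = 0 := by
  constructor
  · exact fun h X Y Z W => ContMDiffMap.ext fun x => (d_three θ X Y Z W x).symm.trans (h _ x)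
  · intro h X x
    have : X = ![X 0, X 1, X 2, X 3] := by ext1 i; fin_cases i <;> rfl
    rw [this, d_three, h]
    rfl

theorem mem_B3_iff (θ : D.Form 3) :
    θ ∈ D.B3 ↔ ∃ β : D.Form 2, ∀ X Y Z, trilinear θ X Y Z = cartan2 (bilinear β) X Y Z := by
  refine exists_congr fun β => ⟨fun h X Y Z => ContMDiffMap.ext fun x => ?_, fun h X x => ?_⟩
  · rw [trilinear_apply, h, d_two]
  · have : X = ![X 0, X 1, X 2] := by ext1 i; fin_cases i <;> rfl
    rw [this, d_two, ← h]
    rfl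

theorem form_three_ext {θ η : D.Form 3} (h : ∀ X Y Z, trilinear θ X Y Z = trilinear η X Y Z)
    [T2Space M] : θ = η := by
  refine Subtype.ext (funext fun x => AlternatingMap.ext fun v => ?_)
  have h2 := congrArg (fun f : SmoothFunction n M => f x)
    (h (D.extend x (v 0)) (D.extend x (v 1)) (D.extend x (v 2)))
  have h3 : (fun i => val (![D.extend x (v 0), D.extend x (v 1), D.extend x (v 2)] i) x) = v := by
    ext1 i
    fin_cases i <;> exact val_extend x _
  simp only [trilinear_apply, eval, h3] at h2
  exact h2

variable [T2Space M]

theorem trilinear_congr (C : D.Sections →ₗ[SmoothFunction n M] D.Sections →ₗ[SmoothFunction n M]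
    D.Sections →ₗ[SmoothFunction n M] SmoothFunction n M) {X X' Y Y' Z Z' : D.Sections} {x : M}
    (hX : val X x = val X' x) (hY : val Y x = val Y' x) (hZ : val Z x = val Z' x) :
    C X Y Z x = C X' Y' Z' x :=
  calc C X Y Z x = (C.flip Y).flip Z X x := rfl
    _ = (C.flip Y).flip Z X' x := dual_apply_congr _ hX
    _ = (C X').flip Z Y x := rfl
    _ = (C X').flip Z Y' x := dual_apply_congr _ hY
    _ = C X' Y' Z x := rfl
    _ = C X' Y' Z' x := dual_apply_congr _ hZ

theorem bilinear_congr (β : D.Sections →ₗ[SmoothFunction n M] D.Sections →ₗ[SmoothFunction n M]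
    SmoothFunction n M) {X X' Y Y' : D.Sections} {x : M}
    (hX : val X x = val X' x) (hY : val Y x = val Y' x) : β X Y x = β X' Y' x :=
  calc β X Y x = β.flip Y X x := rfl
    _ = β.flip Y X' x := dual_apply_congr _ hX
    _ = β X' Y x := rfl
    _ = β X' Y' x := dual_apply_congr _ hY

/-- The `3`-form on `D` of an alternating trilinear form on sections. -/
def ofTrilinear (C : D.Sections →ₗ[SmoothFunction n M] D.Sections →ₗ[SmoothFunction n M]
    D.Sections →ₗ[SmoothFunction n M] SmoothFunction n M) (h12 : ∀ X Z, C X X Z = 0)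
    (h23 : ∀ X Z, C X Z Z = 0) : D.Form 3 where
  val x :=
    { toFun := fun v => C (D.extend x (v 0)) (D.extend x (v 1)) (D.extend x (v 2)) x
      map_update_add' := by
        intro inst v i a b
        obtain rfl : inst = instDecidableEqFin 3 := Subsingleton.elim _ _
        fin_cases i <;> simp [Function.update]
      map_update_smul' := by
        intro inst v i c a
        obtain rfl : inst = instDecidableEqFin 3 := Subsingleton.elim _ _
        have hx : ∀ f : SmoothFunction n M, (algebraMap ℝ (SmoothFunction n M) c * f) x = c * f x :=
          fun _ => rfl
        fin_cases i <;> simp [Function.update, ← const_smul_sections, hx, -ContMDiffMap.coe_mul]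
      map_eq_zero_of_eq' := fun v i j hv hij => by
        have h13 : ∀ X Z, C X Z X = 0 := fun X Z => by rw [swap12 h12, h23, neg_zero]
        wlog h : i < j generalizing i j
        · exact this j i hv.symm hij.symm (lt_of_le_of_ne (not_lt.1 h) hij.symm)
        obtain ⟨rfl, rfl⟩ | ⟨rfl, rfl⟩ | ⟨rfl, rfl⟩ :
            (i = 0 ∧ j = 1) ∨ (i = 0 ∧ j = 2) ∨ (i = 1 ∧ j = 2) := by omega
        · rw [hv, h12]; rfl
        · rw [hv, h13]; rfl
        · rw [hv, h23]; rfl }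
  property X := by
    refine (C (X 0) (X 1) (X 2)).contMDiff.congr fun x => ?_
    exact trilinear_congr C (val_extend x _) (val_extend x _) (val_extend x _)

theorem eval_ofTrilinear (C : D.Sections →ₗ[SmoothFunction n M] D.Sections →ₗ[SmoothFunction n M]
    D.Sections →ₗ[SmoothFunction n M] SmoothFunction n M) (h12 h23) (X Y Z : D.Sections) (x : M) :
    eval (ofTrilinear C h12 h23) ![X, Y, Z] x = C X Y Z x :=
  trilinear_congr C (val_extend x _) (val_extend x _) (val_extend x _)

theorem trilinear_ofTrilinear (C : D.Sections →ₗ[SmoothFunction n M] D.Sections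
    →ₗ[SmoothFunction n M] D.Sections →ₗ[SmoothFunction n M] SmoothFunction n M) (h12 h23) :
    trilinear (ofTrilinear C h12 h23) = C :=
  LinearMap.ext fun X => LinearMap.ext fun Y => LinearMap.ext fun Z => ContMDiffMap.ext fun x =>
    eval_ofTrilinear C h12 h23 X Y Z x

/-- The `2`-form on `D` of an alternating bilinear form on sections. -/
def ofBilinear (β : D.Sections →ₗ[SmoothFunction n M] D.Sections →ₗ[SmoothFunction n M]
    SmoothFunction n M) (h12 : ∀ X, β X X = 0) : D.Form 2 where
  val x :=
    { toFun := fun v => β (D.extend x (v 0)) (D.extend x (v 1)) x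
      map_update_add' := by
        intro inst v i a b
        obtain rfl : inst = instDecidableEqFin 2 := Subsingleton.elim _ _
        fin_cases i <;> simp [Function.update]
      map_update_smul' := by
        intro inst v i c a
        obtain rfl : inst = instDecidableEqFin 2 := Subsingleton.elim _ _
        have hx : ∀ f : SmoothFunction n M, (algebraMap ℝ (SmoothFunction n M) c * f) x = c * f x :=
          fun _ => rfl
        fin_cases i <;> simp [Function.update, ← const_smul_sections, hx, -ContMDiffMap.coe_mul]
      map_eq_zero_of_eq' := fun v i j hv hij => by
        have h : v 0 = v 1 := by
          obtain ⟨rfl, rfl⟩ | ⟨rfl, rfl⟩ : (i = 0 ∧ j = 1) ∨ (i = 1 ∧ j = 0) := by omega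
          · exact hv
          · exact hv.symm
        rw [h, h12]
        rfl }
  property X := by
    refine (β (X 0) (X 1)).contMDiff.congr fun x => ?_
    exact bilinear_congr β (val_extend x _) (val_extend x _)

theorem bilinear_ofBilinear (β : D.Sections →ₗ[SmoothFunction n M] D.Sections
    →ₗ[SmoothFunction n M] SmoothFunction n M) (h12) : bilinear (ofBilinear β h12) = β :=
  LinearMap.ext fun _ => LinearMap.ext fun _ => ContMDiffMap.ext fun x =>
    bilinear_congr β (val_extend x _) (val_extend x _)

end LieSubalgebroid

end Courant

/-! ### Calculus in a Courant algebroid -/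

namespace Courant

open scoped Topology
open LieSubalgebroid

variable {n : ℕ} {M : Type u} [TopologicalSpace M] [ChartedSpace (EuclideanSpace ℝ (Fin n)) M]
  [IsManifold (𝓡 n) ∞ M]

namespace CourantAlgebroid

variable (A : CourantAlgebroid.{u, v} n M)

/-- The anchor on sections. -/
def anchorSec (φ : A.Sections) : SmoothVectorField n M :=
  ⟨fun x => A.str.anchor x (φ x), A.str.anchor_smooth φ⟩

/-- The pairing of sections. -/
def pair (φ ψ : A.Sections) : SmoothFunction n M :=
  ⟨fun x => A.str.pairing x (φ x) (ψ x), A.str.pairing_smooth φ ψ⟩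

theorem anchorSec_apply (φ : A.Sections) (x : M) : A.anchorSec φ x = A.str.anchor x (φ x) := rfl

theorem pair_apply (φ ψ : A.Sections) (x : M) : A.pair φ ψ x = A.str.pairing x (φ x) (ψ x) := rfl

variable {A}

theorem pair_comm (φ ψ : A.Sections) : A.pair φ ψ = A.pair ψ φ :=
  ContMDiffMap.ext fun x => A.str.pairing_symm x _ _

theorem pair_add_left (φ φ' ψ : A.Sections) : A.pair (φ + φ') ψ = A.pair φ ψ + A.pair φ' ψ :=
  ContMDiffMap.ext fun x => by
    change A.str.pairing x (φ x + φ' x) (ψ x) = _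
    rw [map_add]; rfl

theorem pair_add_right (φ ψ ψ' : A.Sections) : A.pair φ (ψ + ψ') = A.pair φ ψ + A.pair φ ψ' := by
  rw [pair_comm, pair_add_left, pair_comm ψ, pair_comm ψ']

theorem pair_smul_left (f : SmoothFunction n M) (φ ψ : A.Sections) :
    A.pair (f • φ) ψ = f * A.pair φ ψ :=
  ContMDiffMap.ext fun x => by
    change A.str.pairing x (f x • φ x) (ψ x) = _
    rw [map_smul]; rfl

theorem pair_smul_right (f : SmoothFunction n M) (φ ψ : A.Sections) :
    A.pair φ (f • ψ) = f * A.pair φ ψ := by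
  rw [pair_comm, pair_smul_left, pair_comm]

theorem bracket_smul (φ ψ : A.Sections) (f : SmoothFunction n M) :
    A.str.bracket φ (f • ψ) = f • A.str.bracket φ ψ + lieDeriv (A.anchorSec φ) f • ψ :=
  ContMDiffSection.ext fun x =>
    (A.str.leibniz φ ψ (f • ψ) f f.contMDiff (fun _ => rfl) x).trans (add_comm _ _)

theorem pair_bracket_self (φ χ : A.Sections) :
    A.pair (A.str.bracket φ φ) χ + A.pair (A.str.bracket φ φ) χ =
      lieDeriv (A.anchorSec χ) (A.pair φ φ) :=
  ContMDiffMap.ext fun x => by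
    change A.str.pairing x _ _ + A.str.pairing x _ _ = dirDeriv _ x _
    rw [A.str.bracket_self, ← two_mul, ← mul_assoc]
    norm_num
    rfl

theorem lieDeriv_pair_self (φ ψ : A.Sections) :
    lieDeriv (A.anchorSec φ) (A.pair ψ ψ) =
      A.pair (A.str.bracket φ ψ) ψ + A.pair (A.str.bracket φ ψ) ψ :=
  ContMDiffMap.ext fun x => (A.str.invariant φ ψ x).trans (two_mul _)

/-- The polarization of `[φ, φ] = ½ ρ^* d⟨φ, φ⟩`. -/
theorem pair_bracket_add_swap (φ ψ χ : A.Sections) :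
    A.pair (A.str.bracket φ ψ) χ + A.pair (A.str.bracket ψ φ) χ =
      lieDeriv (A.anchorSec χ) (A.pair φ ψ) := by
  have h := pair_bracket_self (φ + ψ) χ
  have h1 := pair_bracket_self φ χ
  have h2 := pair_bracket_self ψ χ
  simp only [map_add, LinearMap.add_apply, pair_add_left, pair_add_right, lieDeriv_add] at h
  rw [pair_comm ψ φ] at h
  refine add_self_cancel ?_
  linear_combination h - h1 - h2

/-- The polarization of `ρ(φ)⟨ψ, ψ⟩ = 2⟨[φ, ψ], ψ⟩`. -/
theorem lieDeriv_pair (φ ψ χ : A.Sections) :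
    lieDeriv (A.anchorSec φ) (A.pair ψ χ) =
      A.pair (A.str.bracket φ ψ) χ + A.pair ψ (A.str.bracket φ χ) := by
  have h := lieDeriv_pair_self φ (ψ + χ)
  have h1 := lieDeriv_pair_self φ ψ
  have h2 := lieDeriv_pair_self φ χ
  simp only [map_add, pair_add_left, pair_add_right, lieDeriv_add] at h
  rw [pair_comm χ ψ] at h
  rw [pair_comm ψ (A.str.bracket φ χ)]
  refine add_self_cancel ?_
  linear_combination h - h1 - h2

instance (x : M) : FiniteDimensional ℝ (A.E x) :=
  ((trivializationAt A.F A.E x).linearEquivAt ℝ x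
    (FiberBundle.mem_baseSet_trivializationAt' x)).symm.finiteDimensional

theorem finrank_fiber (x : M) : Module.finrank ℝ (A.E x) = Module.finrank ℝ A.F :=
  ((trivializationAt A.F A.E x).linearEquivAt ℝ x
    (FiberBundle.mem_baseSet_trivializationAt' x)).finrank_eq

theorem pairing_injective (x : M) : Function.Injective (A.str.pairing x) := by
  refine LinearMap.ker_eq_bot.1 (LinearMap.ker_eq_bot'.2 fun v hv => ?_)
  exact A.str.pairing_nondegenerate x v fun w => by rw [hv]; rfl

theorem eq_of_pairing_eq {x : M} {v w : A.E x}
    (h : ∀ u, A.str.pairing x v u = A.str.pairing x w u) : v = w :=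
  pairing_injective x (LinearMap.ext h)

variable (A) in
/-- The pseudo-metric as an isomorphism of a fibre with its dual. -/
def pairingEquiv (x : M) : A.E x ≃ₗ[ℝ] Module.Dual ℝ (A.E x) :=
  LinearEquiv.ofInjectiveOfFinrankEq (A.str.pairing x) (pairing_injective x)
    Subspace.dual_finrank_eq.symm

theorem pairing_pairingEquiv_symm (x : M) (ξ : Module.Dual ℝ (A.E x)) (w : A.E x) :
    A.str.pairing x ((A.pairingEquiv x).symm ξ) w = ξ w :=
  LinearMap.congr_fun ((A.pairingEquiv x).apply_symm_apply ξ) w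

variable [T2Space M]

/-- The anchor is a morphism of brackets. This is a consequence of the Leibniz rule and the Jacobi
identity over the points where `E` has a nonzero fibre; over the others the anchor is zero. -/
theorem anchorSec_bracket (φ ψ : A.Sections) :
    A.anchorSec (A.str.bracket φ ψ) = ⁅A.anchorSec φ, A.anchorSec ψ⁆ := by
  ext x
  refine tangent_ext fun f => ?_
  change lieDeriv _ f x = lieDeriv _ f x
  rw [lieDeriv_lie]
  have key : ∀ χ : A.Sections, χ x ≠ 0 → lieDeriv (A.anchorSec (A.str.bracket φ ψ)) f x =
      (lieDeriv (A.anchorSec φ) (lieDeriv (A.anchorSec ψ) f)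
        - lieDeriv (A.anchorSec ψ) (lieDeriv (A.anchorSec φ) f)) x := by
    intro χ hχ
    have h := anchor_commutator_of_jacobi (A := SmoothFunction n M) (S := A.Sections)
      (fun φ ψ => A.str.bracket φ ψ) (fun φ f => lieDeriv (A.anchorSec φ) f)
      (fun a b c => map_add _ b c) bracket_smul A.str.jacobi φ ψ χ f
    have h2 := congrArg (fun s : A.Sections => s x) h
    exact sub_eq_zero.1 ((smul_eq_zero.1 h2).resolve_right hχ)
  by_cases hE : ∃ v : A.E x, v ≠ 0
  · obtain ⟨v, hv⟩ := hE
    obtain ⟨χ, hχ⟩ := exists_section_apply_eq (n := n) (F := A.F) x v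
    exact key χ (hχ ▸ hv)
  · push Not at hE
    have h0 : ∀ φ : A.Sections, A.anchorSec φ x = 0 := fun φ => by
      rw [anchorSec_apply, hE (φ x), map_zero]
    change dirDeriv _ x _ = dirDeriv _ x _ - dirDeriv _ x _
    rw [h0, h0, h0, dirDeriv_tangent_zero, dirDeriv_tangent_zero, dirDeriv_tangent_zero, sub_zero]

/-- A set-theoretic section whose pairings with the smooth sections are smooth is smooth: in a
local frame its coefficients arise from these pairings by the inverse of the Gram matrix. -/
theorem contMDiff_of_pairing (t : ∀ x, A.E x)
    (ht : ∀ ψ : A.Sections, ContMDiff (𝓡 n) 𝓘(ℝ, ℝ) ∞ (fun x => A.str.pairing x (t x) (ψ x))) :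
    ContMDiff (𝓡 n) ((𝓡 n).prod 𝓘(ℝ, A.F)) ∞ (fun x => (⟨x, t x⟩ : TotalSpace A.F A.E)) := by
  intro x₀
  let b := Module.finBasis ℝ (A.E x₀)
  choose s hs using fun i => exists_section_apply_eq (n := n) (F := A.F) x₀ (b i)
  obtain ⟨V, -, hV, hxV, c, hc, -⟩ := exists_dual_functionals (n := n) A.F
    (s := fun i x => s i x) isOpen_univ (Set.mem_univ x₀) (fun i => (s i).contMDiff.contMDiffOn)
    (by simpa only [hs] using b.linearIndependent)
  have hli : ∀ x ∈ V, LinearIndependent ℝ (fun i => s i x) := fun x hx => by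
    refine Fintype.linearIndependent_iff.2 fun a ha j => ?_
    have := congrArg (c j x) ha
    rw [map_sum, map_zero] at this
    simpa [map_smul, hc x hx] using this
  have hcard : ∀ x, Fintype.card (Fin (Module.finrank ℝ (A.E x₀))) = Module.finrank ℝ (A.E x) :=
    fun x => by rw [Fintype.card_fin, finrank_fiber, finrank_fiber]
  have hspan : ∀ x ∈ V, ∀ v : A.E x, ∑ j, c j x v • s j x = v := fun x hx v => by
    have h := (hli x hx).span_eq_top_of_card_eq_finrank' (hcard x)
    obtain ⟨a, rfl⟩ := (Submodule.mem_span_range_iff_exists_fun ℝ).1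
      (h ▸ Submodule.mem_top : v ∈ Submodule.span ℝ (Set.range fun i => s i x))
    simp only [map_sum, map_smul, hc x hx]
    simp
  -- `G` is the Gram matrix of the frame.
  let G : M → Matrix (Fin (Module.finrank ℝ (A.E x₀))) (Fin (Module.finrank ℝ (A.E x₀))) ℝ :=
    fun x => Matrix.of fun i j => A.pair (s i) (s j) x
  have hG : ∀ i j, ContMDiffAt (𝓡 n) 𝓘(ℝ, ℝ) ∞ (fun x => G x i j) x₀ := fun i j =>
    (A.pair (s i) (s j)).contMDiff.contMDiffAt
  have hG0 : ∀ x ∈ V, (G x).det ≠ 0 := fun x hx h0 => by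
    obtain ⟨a, ha, hGa⟩ := Matrix.exists_vecMul_eq_zero_iff.2 h0
    refine ha ?_
    have hz : ∑ i, a i • s i x = 0 := by
      refine A.str.pairing_nondegenerate x _ fun w => ?_
      rw [← hspan x hx w]
      simp only [map_sum, map_smul, LinearMap.sum_apply, LinearMap.smul_apply, smul_eq_mul]
      refine Finset.sum_eq_zero fun j _ => ?_
      have := congrFun hGa j
      simp only [Matrix.vecMul, dotProduct, Pi.zero_apply] at this
      have h2 : ∑ i, a i * A.str.pairing x (s i x) (s j x) = 0 := this
      rw [h2, mul_zero]
    exact funext fun i => Fintype.linearIndependent_iff.1 (hli x hx) a hz i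
  have hexp : ∀ x ∈ V, ∑ i, (∑ j, A.str.pairing x (t x) (s j x) * (G x)⁻¹ j i) • s i x = t x := by
    intro x hx
    have hci : ∀ i, ∑ j, A.str.pairing x (t x) (s j x) * (G x)⁻¹ j i = c i x (t x) := by
      have h1 : (fun j => A.str.pairing x (t x) (s j x)) = Matrix.vecMul (fun i => c i x (t x))
          (G x) := by
        ext j
        conv_lhs => rw [← hspan x hx (t x)]
        simp only [map_sum, map_smul, LinearMap.sum_apply, LinearMap.smul_apply, smul_eq_mul]
        rfl
      intro i
      have h2 : Matrix.vecMul (fun j => A.str.pairing x (t x) (s j x)) (G x)⁻¹ =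
          fun i => c i x (t x) := by
        rw [h1, Matrix.vecMul_vecMul, Matrix.mul_nonsing_inv _ (isUnit_iff_ne_zero.2 (hG0 x hx)),
          Matrix.vecMul_one]
      exact congrFun h2 i
    simp only [hci]
    exact hspan x hx (t x)
  have hsm : ContMDiffAt (𝓡 n) ((𝓡 n).prod 𝓘(ℝ, A.F)) ∞ (fun x => (⟨x,
      ∑ i, (∑ j, A.str.pairing x (t x) (s j x) * (G x)⁻¹ j i) • s i x⟩ : TotalSpace A.F A.E)) x₀ :=
    ContMDiffAt.sum_section fun i _ => ContMDiffAt.smul_section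
      (f := fun x => ∑ j, A.str.pairing x (t x) (s j x) * (G x)⁻¹ j i)
      (contMDiffAt_finsetSum fun j _ => (ht (s j)).contMDiffAt.mul
        (contMDiffAt_matrix_inv hG (hG0 x₀ hxV) j i)) (s i).contMDiff.contMDiffAt
  refine hsm.congr_of_eventuallyEq ?_
  filter_upwards [hV.mem_nhds hxV] with x hx
  rw [hexp x hx]

end CourantAlgebroid

end Courant

/-! ### The splitting of a generalized exact Courant algebroid by an isotropic section -/

namespace Courant

open scoped Topology
open LieSubalgebroid CourantAlgebroid

variable {n : ℕ} {M : Type u} [TopologicalSpace M] [ChartedSpace (EuclideanSpace ℝ (Fin n)) M]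
  [IsManifold (𝓡 n) ∞ M] {D : LieSubalgebroid n M}

namespace GenExact

variable (A : GenExact.{u, v} D)

/-- The anchor as a map onto `D`. -/
def rho (x : M) : A.1.E x →ₗ[ℝ] D.fiber x :=
  (A.1.str.anchor x).codRestrict (D.fiber x) fun v => by
    rw [← A.2.2 x]
    exact LinearMap.mem_range_self _ v

theorem rho_surjective (x : M) : Function.Surjective (A.rho x) := by
  rintro ⟨w, hw⟩
  rw [← A.2.2 x] at hw
  obtain ⟨v, hv⟩ := hw
  exact ⟨v, Subtype.ext hv⟩

/-- The anchor on sections. -/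
def rhoSec (φ : A.1.Sections) : D.Sections :=
  ⟨A.1.anchorSec φ, fun x => (A.rho x (φ x)).2⟩

theorem val_rhoSec (φ : A.1.Sections) (x : M) : val (A.rhoSec φ) x = A.rho x (φ x) := rfl

theorem rhoSec_add (φ ψ : A.1.Sections) : A.rhoSec (φ + ψ) = A.rhoSec φ + A.rhoSec ψ :=
  sections_ext fun x => map_add (A.rho x) (φ x) (ψ x)

theorem lieDeriv_anchorSec (φ : A.1.Sections) (f : SmoothFunction n M) :
    lieDeriv (A.1.anchorSec φ) f = ⁅A.rhoSec φ, f⁆ := rfl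

/-- The adjoint `ρ^* : D^* → E` of the anchor. -/
def rhoStar (x : M) : Module.Dual ℝ (D.fiber x) →ₗ[ℝ] A.1.E x :=
  (A.1.pairingEquiv x).symm.toLinearMap ∘ₗ (A.rho x).dualMap

theorem pairing_rhoStar (x : M) (α : Module.Dual ℝ (D.fiber x)) (w : A.1.E x) :
    A.1.str.pairing x (A.rhoStar x α) w = α (A.rho x w) :=
  pairing_pairingEquiv_symm x _ w

theorem rho_rhoStar (x : M) (α : Module.Dual ℝ (D.fiber x)) : A.rho x (A.rhoStar x α) = 0 := by
  refine Subtype.ext ((A.2.1.2 x _).2 ⟨α ∘ₗ Submodule.inclusion (A.2.2 x).le, fun w => ?_⟩)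
  rw [pairing_rhoStar]
  rfl

theorem exists_eq_rhoStar {x : M} {v : A.1.E x} (hv : A.rho x v = 0) :
    ∃ α : Module.Dual ℝ (D.fiber x), v = A.rhoStar x α := by
  obtain ⟨α, hα⟩ := (A.2.1.2 x v).1 (congrArg Subtype.val hv)
  refine ⟨α ∘ₗ Submodule.inclusion (A.2.2 x).ge, eq_of_pairing_eq fun u => ?_⟩
  rw [hα, pairing_rhoStar]
  rfl

section Smooth

variable [T2Space M]

theorem rhoSec_bracket (φ ψ : A.1.Sections) :
    A.rhoSec (A.1.str.bracket φ ψ) = ⁅A.rhoSec φ, A.rhoSec ψ⁆ :=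
  Subtype.ext (anchorSec_bracket φ ψ)

/-- The section `ρ^* α` for a `1`-form `α` on `D`. -/
def rhoStarSec (α : Module.Dual (SmoothFunction n M) D.Sections) : A.1.Sections :=
  ⟨fun x => A.rhoStar x (dualAt α x), contMDiff_of_pairing _ fun ψ =>
    (α (A.rhoSec ψ)).contMDiff.congr fun x => by
      rw [pairing_rhoStar, ← val_rhoSec, dualAt_val]⟩

theorem rhoStarSec_apply (α : Module.Dual (SmoothFunction n M) D.Sections) (x : M) :
    A.rhoStarSec α x = A.rhoStar x (dualAt α x) := rfl

end Smooth

namespace IsotropicSection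

variable {A}

section Basic

variable (σ : IsotropicSection A)

theorem rho_toLin (x : M) (v : D.fiber x) : A.rho x (σ.toLin x v) = v :=
  Subtype.ext (σ.anchor_toLin x v)

theorem rhoSec_onSections (X : D.Sections) : A.rhoSec (σ.onSections X) = X :=
  sections_ext fun x => by rw [val_rhoSec, σ.onSections_apply, rho_toLin]

theorem onSections_add (X Y : D.Sections) :
    σ.onSections (X + Y) = σ.onSections X + σ.onSections Y :=
  ContMDiffSection.ext fun x => by
    change _ = σ.onSections X x + σ.onSections Y x
    rw [σ.onSections_apply, σ.onSections_apply, σ.onSections_apply, val_add, map_add]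

theorem onSections_smul (f : SmoothFunction n M) (X : D.Sections) :
    σ.onSections (f • X) = f • σ.onSections X :=
  ContMDiffSection.ext fun x => by
    change _ = f x • σ.onSections X x
    rw [σ.onSections_apply, σ.onSections_apply, val_smul, map_smul]

theorem pair_onSections (X Y : D.Sections) : A.1.pair (σ.onSections X) (σ.onSections Y) = 0 :=
  ContMDiffMap.ext fun x => by
    rw [pair_apply, σ.onSections_apply, σ.onSections_apply, σ.isotropic]
    rfl

/-- An element is the sum of its lift by `σ` and an element of `ρ^* D^*`. -/
theorem exists_eq_toLin_add_rhoStar {x : M} (v : A.1.E x) :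
    ∃ α : Module.Dual ℝ (D.fiber x), v = σ.toLin x (A.rho x v) + A.rhoStar x α := by
  obtain ⟨α, hα⟩ := A.exists_eq_rhoStar (v := v - σ.toLin x (A.rho x v))
    (by rw [map_sub, rho_toLin, sub_self])
  exact ⟨α, by rw [← hα, add_sub_cancel]⟩

/-- The splitting `E ≅ D ⊕ D^*` turns the pseudo-metric into the standard one. -/
theorem pairing_eq (x : M) (v w : A.1.E x) : A.1.str.pairing x v w =
    A.1.str.pairing x v (σ.toLin x (A.rho x w)) + A.1.str.pairing x w (σ.toLin x (A.rho x v)) := by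
  obtain ⟨α, hα⟩ := σ.exists_eq_toLin_add_rhoStar v
  obtain ⟨β, hβ⟩ := σ.exists_eq_toLin_add_rhoStar w
  generalize A.rho x v = a at *
  generalize A.rho x w = b at *
  subst hα hβ
  have h1 : ∀ u α, A.1.str.pairing x (σ.toLin x u) (A.rhoStar x α) = α u := fun u α => by
    rw [A.1.str.pairing_symm, pairing_rhoStar, rho_toLin]
  simp only [map_add, LinearMap.add_apply, σ.isotropic, h1, pairing_rhoStar, rho_toLin,
    rho_rhoStar, map_zero]
  ring

theorem pair_eq (φ ψ : A.1.Sections) : A.1.pair φ ψ =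
    A.1.pair φ (σ.onSections (A.rhoSec ψ)) + A.1.pair ψ (σ.onSections (A.rhoSec φ)) :=
  ContMDiffMap.ext fun x => by
    change A.1.str.pairing x _ _ = A.1.str.pairing x _ _ + A.1.str.pairing x _ _
    rw [σ.onSections_apply, σ.onSections_apply]
    exact σ.pairing_eq x _ _

/-- The splitting `E ≅ D ⊕ D^*` over a point. -/
def fiberMap (x : M) : A.1.E x →ₗ[ℝ] D.fiber x × Module.Dual ℝ (D.fiber x) :=
  (A.rho x).prod ((A.1.str.pairing x).compl₂ (σ.toLin x))

theorem fiberMap_injective (x : M) : Function.Injective (σ.fiberMap x) := by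
  refine LinearMap.ker_eq_bot.1 (LinearMap.ker_eq_bot'.2 fun v hv => ?_)
  have h1 : A.rho x v = 0 := congrArg Prod.fst hv
  have h2 : ∀ y, A.1.str.pairing x v (σ.toLin x y) = 0 := fun y =>
    LinearMap.congr_fun (congrArg Prod.snd hv) y
  refine A.1.str.pairing_nondegenerate x v fun w => ?_
  rw [σ.pairing_eq, h2, h1, map_zero, map_zero, add_zero]

theorem fiberMap_toLin_add (x : M) (v : D.fiber x) (α : Module.Dual ℝ (D.fiber x)) :
    σ.fiberMap x (σ.toLin x v + A.rhoStar x α) = (v, α) := by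
  refine Prod.ext ?_ (LinearMap.ext fun y => ?_)
  · change A.rho x _ = v
    rw [map_add, rho_toLin, rho_rhoStar, add_zero]
  · change A.1.str.pairing x _ (σ.toLin x y) = α y
    rw [map_add, LinearMap.add_apply, σ.isotropic, zero_add, pairing_rhoStar, rho_toLin]

/-- The splitting `E ≅ D ⊕ D^*` over a point, as an isomorphism. -/
def fiberEquiv (x : M) : A.1.E x ≃ₗ[ℝ] D.fiber x × Module.Dual ℝ (D.fiber x) :=
  LinearEquiv.ofBijective (σ.fiberMap x)
    ⟨σ.fiberMap_injective x, fun p => ⟨_, σ.fiberMap_toLin_add x p.1 p.2⟩⟩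

/-- The splitting `Γ(E) ≅ Γ(D) ⊕ Ω¹(D)`. -/
def split (φ : A.1.Sections) : D.Sections × Module.Dual (SmoothFunction n M) D.Sections :=
  (A.rhoSec φ,
    { toFun := fun Y => A.1.pair φ (σ.onSections Y)
      map_add' := fun Y Z => by rw [onSections_add, pair_add_right]
      map_smul' := fun f Y => by rw [onSections_smul, pair_smul_right]; rfl })

theorem split_fst (φ : A.1.Sections) : (σ.split φ).1 = A.rhoSec φ := rfl

theorem split_snd (φ : A.1.Sections) (Y : D.Sections) :
    (σ.split φ).2 Y = A.1.pair φ (σ.onSections Y) := rfl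

theorem split_add (φ ψ : A.1.Sections) : σ.split (φ + ψ) = σ.split φ + σ.split ψ :=
  Prod.ext (A.rhoSec_add φ ψ) (LinearMap.ext fun _ => pair_add_left φ ψ _)

theorem curvature_swap_left (X Y Z : D.Sections) :
    A.1.pair (A.1.str.bracket (σ.onSections X) (σ.onSections Y)) (σ.onSections Z) =
      - A.1.pair (A.1.str.bracket (σ.onSections Y) (σ.onSections X)) (σ.onSections Z) := by
  rw [eq_neg_iff_add_eq_zero, pair_bracket_add_swap, pair_onSections, lieDeriv_anchorSec, lie_zero]

theorem curvature_smul (f : SmoothFunction n M) (X Y Z : D.Sections) :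
    A.1.pair (A.1.str.bracket (σ.onSections X) (σ.onSections (f • Y))) (σ.onSections Z) =
      f * A.1.pair (A.1.str.bracket (σ.onSections X) (σ.onSections Y)) (σ.onSections Z) := by
  rw [onSections_smul, bracket_smul, pair_add_left, pair_smul_left, pair_smul_left,
    pair_onSections, mul_zero, add_zero]

/-- The curvature `⟨[σ X, σ Y], σ Z⟩` of an isotropic section; the term `⟨σ [X, Y], σ Z⟩` of the
Ševera form vanishes. -/
def curvature : D.Sections →ₗ[SmoothFunction n M] D.Sections →ₗ[SmoothFunction n M]
    D.Sections →ₗ[SmoothFunction n M] SmoothFunction n M :=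
  mkTrilinear (fun X Y Z =>
      A.1.pair (A.1.str.bracket (σ.onSections X) (σ.onSections Y)) (σ.onSections Z))
    (fun X X' Y Z => by rw [onSections_add, map_add, LinearMap.add_apply, pair_add_left])
    (fun a X Y Z => by
      rw [curvature_swap_left, curvature_smul, curvature_swap_left, mul_neg, neg_neg])
    (fun X Y Y' Z => by rw [onSections_add, map_add, pair_add_left])
    (fun a X Y Z => σ.curvature_smul a X Y Z)
    (fun X Y Z Z' => by rw [onSections_add, pair_add_right])
    (fun a X Y Z => by rw [onSections_smul, pair_smul_right])

theorem curvature_apply (X Y Z : D.Sections) : σ.curvature X Y Z =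
    A.1.pair (A.1.str.bracket (σ.onSections X) (σ.onSections Y)) (σ.onSections Z) := rfl

theorem curvature_self_left (X Z : D.Sections) : σ.curvature X X Z = 0 := by
  refine add_self_cancel ?_
  rw [curvature_apply, pair_bracket_self, pair_onSections, lieDeriv_anchorSec, lie_zero, add_zero]

theorem curvature_self_right (X Z : D.Sections) : σ.curvature X Z Z = 0 := by
  refine add_self_cancel ?_
  rw [curvature_apply, ← lieDeriv_pair_self, pair_onSections, lieDeriv_anchorSec, lie_zero,
    add_zero]

end Basic

section Smooth

variable [T2Space M] (σ : IsotropicSection A)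

theorem fiberEquiv_apply (φ : A.1.Sections) (x : M) :
    σ.fiberEquiv x (φ x) = (val (σ.split φ).1 x, dualAt (σ.split φ).2 x) := by
  refine Prod.ext rfl (LinearMap.ext fun y => ?_)
  obtain ⟨Y, rfl⟩ := evalAt_surjective x y
  refine Eq.trans ?_ (dualAt_val _ Y x).symm
  change A.1.str.pairing x (φ x) (σ.toLin x (val Y x)) = A.1.str.pairing x (φ x) _
  rw [σ.onSections_apply]

theorem split_injective : Function.Injective σ.split := fun φ ψ h =>
  ContMDiffSection.ext fun x => (σ.fiberEquiv x).injective (by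
    rw [fiberEquiv_apply, fiberEquiv_apply, h])

theorem split_onSections_add (X : D.Sections) (α : Module.Dual (SmoothFunction n M) D.Sections) :
    σ.split (σ.onSections X + A.rhoStarSec α) = (X, α) := by
  refine Prod.ext (sections_ext fun x => ?_) (LinearMap.ext fun Y => ContMDiffMap.ext fun x => ?_)
  · change A.rho x (σ.onSections X x + A.rhoStarSec α x) = val X x
    rw [σ.onSections_apply, rhoStarSec_apply, map_add, rho_toLin, rho_rhoStar, add_zero]
  · change A.1.str.pairing x (σ.onSections X x + A.rhoStarSec α x) (σ.onSections Y x) = α Y x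
    rw [σ.onSections_apply, rhoStarSec_apply, σ.onSections_apply, map_add, LinearMap.add_apply,
      σ.isotropic, pairing_rhoStar, rho_toLin, zero_add, dualAt_val]

/-- The splitting `Γ(E) ≅ Γ(D) ⊕ Ω¹(D)`, as a bijection. -/
def splitEquiv : A.1.Sections ≃ D.Sections × Module.Dual (SmoothFunction n M) D.Sections :=
  Equiv.ofBijective σ.split
    ⟨σ.split_injective, fun p => ⟨_, σ.split_onSections_add p.1 p.2⟩⟩

theorem splitEquiv_apply (φ : A.1.Sections) : σ.splitEquiv φ = σ.split φ := rfl

/-- In the splitting given by an isotropic section the bracket is the Dorfman bracket twisted by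
the curvature. -/
theorem split_bracket (φ ψ : A.1.Sections) :
    σ.split (A.1.str.bracket φ ψ) = dorfman σ.curvature (σ.split φ) (σ.split ψ) := by
  refine Prod.ext (A.rhoSec_bracket φ ψ) (LinearMap.ext fun Z => ?_)
  rw [dorfman_snd, split_snd]
  simp only [split_fst, split_snd]
  have hρ : ∀ φ ψ : A.1.Sections, A.1.pair φ ψ = A.1.pair φ (σ.onSections (A.rhoSec ψ))
    + A.1.pair ψ (σ.onSections (A.rhoSec φ)) := σ.pair_eq
  have e1 : ⁅A.rhoSec φ, A.1.pair ψ (σ.onSections Z)⁆ =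
      A.1.pair (A.1.str.bracket φ ψ) (σ.onSections Z)
        + A.1.pair ψ (A.1.str.bracket φ (σ.onSections Z)) := lieDeriv_pair φ ψ (σ.onSections Z)
  have e2 := hρ ψ (A.1.str.bracket φ (σ.onSections Z))
  rw [rhoSec_bracket, rhoSec_onSections] at e2
  have e3 := pair_bracket_add_swap φ (σ.onSections Z) (σ.onSections (A.rhoSec ψ))
  rw [lieDeriv_anchorSec, rhoSec_onSections] at e3
  have e4 := lieDeriv_pair (σ.onSections Z) φ (σ.onSections (A.rhoSec ψ))
  rw [lieDeriv_anchorSec, rhoSec_onSections] at e4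
  have e5 := hρ φ (A.1.str.bracket (σ.onSections Z) (σ.onSections (A.rhoSec ψ)))
  rw [rhoSec_bracket, rhoSec_onSections, rhoSec_onSections] at e5
  have e6 : A.1.pair φ (σ.onSections ⁅Z, A.rhoSec ψ⁆) =
      - A.1.pair φ (σ.onSections ⁅A.rhoSec ψ, Z⁆) := by
    rw [← split_snd, ← split_snd, ← lie_skew, map_neg]
  have e7 : A.1.pair (A.1.str.bracket (σ.onSections Z) (σ.onSections (A.rhoSec ψ)))
      (σ.onSections (A.rhoSec φ)) = - σ.curvature (A.rhoSec φ) (A.rhoSec ψ) Z := by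
    rw [← curvature_apply, swap23 σ.curvature_self_right, swap12 σ.curvature_self_left,
      swap23 σ.curvature_self_right, neg_neg]
  linear_combination -e1 - e2 - e3 - e4 - e5 - e6 - e7

end Smooth

end IsotropicSection

end GenExact

end Courant

/-! ### Existence, change and comparison of isotropic sections -/

namespace Courant

open scoped Topology
open LieSubalgebroid CourantAlgebroid

variable {n : ℕ} {M : Type u} [TopologicalSpace M] [ChartedSpace (EuclideanSpace ℝ (Fin n)) M]
  [IsManifold (𝓡 n) ∞ M] {D : LieSubalgebroid n M}

namespace GenExact

namespace IsotropicSection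

variable {A B : GenExact.{u, v} D}

/-- The difference of two isotropic sections: `σ' - σ` takes values in the kernel `ρ^* D^*` of the
anchor, and so corresponds to the form `(X, Y) ↦ ⟨σ' X - σ X, σ Y⟩ = ⟨σ' X, σ Y⟩`. -/
def difference (σ σ' : IsotropicSection A) : D.Sections →ₗ[SmoothFunction n M]
    D.Sections →ₗ[SmoothFunction n M] SmoothFunction n M :=
  LinearMap.mk₂ _ (fun X Y => A.1.pair (σ'.onSections X) (σ.onSections Y))
    (fun X X' Y => by rw [onSections_add, pair_add_left])
    (fun a X Y => by rw [onSections_smul, pair_smul_left]; rfl)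
    (fun X Y Y' => by rw [onSections_add, pair_add_right])
    (fun a X Y => by rw [onSections_smul, pair_smul_right]; rfl)

theorem split_onSections_of (σ σ' : IsotropicSection A) (X : D.Sections) :
    σ.split (σ'.onSections X) = (X, difference σ σ' X) :=
  Prod.ext (σ'.rhoSec_onSections X) rfl

theorem difference_self (σ σ' : IsotropicSection A) (X : D.Sections) :
    difference σ σ' X X = 0 := by
  refine add_self_cancel ?_
  have h := σ.pair_eq (σ'.onSections X) (σ'.onSections X)
  rw [rhoSec_onSections, pair_onSections] at h
  rw [add_zero]
  exact h.symm

/-- An isomorphism carries isotropic sections to isotropic sections with the same curvature. -/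
theorem exists_curvature_eq_of_iso (Ψ : CourantAlgebroid.Iso A.1 B.1) (σ : IsotropicSection A) :
    ∃ σ' : IsotropicSection B, σ'.curvature = σ.curvature := by
  refine ⟨{
    toLin := fun x => (Ψ.toEquiv x).toLinearMap ∘ₗ σ.toLin x
    onSections := fun X => Ψ.onSections (σ.onSections X)
    onSections_apply := fun X x => by
      rw [Ψ.onSections_apply, σ.onSections_apply]; rfl
    anchor_toLin := fun x v => (Ψ.anchor_comp x _).trans (σ.anchor_toLin x v)
    isotropic := fun x v w => (Ψ.pairing_comp x _ _).trans (σ.isotropic x v w) }, ?_⟩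
  refine LinearMap.ext fun X => LinearMap.ext fun Y => LinearMap.ext fun Z =>
    ContMDiffMap.ext fun x => ?_
  change B.1.str.pairing x (B.1.str.bracket (Ψ.onSections _) (Ψ.onSections _) x)
    (Ψ.onSections _ x) = A.1.str.pairing x _ _
  rw [← Ψ.bracket_comp, Ψ.onSections_apply, Ψ.onSections_apply, Ψ.pairing_comp]

end IsotropicSection

variable [T2Space M]

/-- An isotropic section from fibrewise isotropic splittings that pair smoothly with sections. -/
def mkIsotropicSection (A : GenExact.{u, v} D) (τ : ∀ x, D.fiber x →ₗ[ℝ] A.1.E x)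
    (hρ : ∀ x v, A.rho x (τ x v) = v)
    (hiso : ∀ x v w, A.1.str.pairing x (τ x v) (τ x w) = 0)
    (hτ : ∀ (X : D.Sections) (ψ : A.1.Sections),
      ContMDiff (𝓡 n) 𝓘(ℝ, ℝ) ∞ (fun x => A.1.str.pairing x (τ x (val X x)) (ψ x))) :
    IsotropicSection A where
  toLin := τ
  onSections X := ⟨fun x => τ x (val X x), contMDiff_of_pairing _ (hτ X)⟩
  onSections_apply _ _ := rfl
  anchor_toLin x v := congrArg Subtype.val (hρ x v)
  isotropic := hiso

section Existence

variable (A : GenExact.{u, v} D)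

/-- Lifts of a local frame of `D` split the anchor locally. -/
theorem exists_local_splitting (x₀ : M) : ∃ U : Set M, IsOpen U ∧ x₀ ∈ U ∧
    ∃ τ : ∀ x, D.fiber x →ₗ[ℝ] A.1.E x, (∀ x ∈ U, ∀ v, A.rho x (τ x v) = v) ∧
      ∀ (X : D.Sections) (ψ : A.1.Sections), ContMDiffOn (𝓡 n) 𝓘(ℝ, ℝ) ∞
        (fun x => A.1.str.pairing x (τ x (val X x)) (ψ x)) U := by
  let b := (Module.finBasis ℝ (D.fiber x₀)).reindex (finCongr (D.finrank_fiber x₀))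
  choose w hw using fun i => A.rho_surjective x₀ (b i)
  choose a ha using fun i => exists_section_apply_eq (n := n) (F := A.1.F) x₀ (w i)
  obtain ⟨Φ, hΦe, hΦ⟩ := exists_localFrame (Fintype.card_fin _) (fun i => A.rhoSec (a i)) x₀ (by
    simpa only [val_rhoSec, ha, hw] using b.linearIndependent)
  refine ⟨Φ.U, Φ.isOpen, hΦ, fun x => ∑ j, (Φ.coeff j x).smulRight (a j x), fun x hx v => ?_,
    fun X ψ => ?_⟩
  · refine Eq.trans ?_ (Φ.sum_coeff x hx v)
    simp only [LinearMap.sum_apply, LinearMap.smulRight_apply, map_sum, map_smul, hΦe, val_rhoSec]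
  · simp only [LinearMap.sum_apply, LinearMap.smulRight_apply, map_sum, map_smul,
      LinearMap.smul_apply, smul_eq_mul]
    exact contMDiffOn_finsetSum fun j _ =>
      (Φ.smooth X j).mul (A.1.pair (a j) ψ).contMDiff.contMDiffOn

/-- The local splittings of the anchor glue by a partition of unity. -/
theorem exists_splitting [SigmaCompactSpace M] : ∃ τ : ∀ x, D.fiber x →ₗ[ℝ] A.1.E x,
    (∀ x v, A.rho x (τ x v) = v) ∧ ∀ (X : D.Sections) (ψ : A.1.Sections),
      ContMDiff (𝓡 n) 𝓘(ℝ, ℝ) ∞ (fun x => A.1.str.pairing x (τ x (val X x)) (ψ x)) := by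
  choose U hU hxU τ hτ hτs using A.exists_local_splitting
  obtain ⟨P, hP⟩ := SmoothPartitionOfUnity.exists_isSubordinate (𝓡 n) isClosed_univ U hU
    (fun x _ => Set.mem_iUnion.2 ⟨x, hxU x⟩)
  refine ⟨fun x => ∑ p ∈ P.finsupport x, P p x • τ p x, fun x v => ?_, fun X ψ => ?_⟩
  · simp only [LinearMap.sum_apply, LinearMap.smul_apply, map_sum, map_smul]
    have h : ∀ p ∈ P.finsupport x, P p x • A.rho x (τ p x v) = P p x • v := fun p hp => by
      rw [hτ p x (hP p (subset_tsupport _ ((P.mem_finsupport x).1 hp)))]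
    rw [Finset.sum_congr rfl h, ← Finset.sum_smul, P.sum_finsupport x (Set.mem_univ x), one_smul]
  · refine (P.contMDiff_finsum_smul
      (g := fun p x => A.1.str.pairing x (τ p x (val X x)) (ψ x)) fun p x hx =>
      (hτs p X ψ).contMDiffAt ((hU p).mem_nhds (hP p hx))).congr fun x => ?_
    refine Eq.trans ?_ (P.sum_finsupport_smul_eq_finsum x
      fun p x => A.1.str.pairing x (τ p x (val X x)) (ψ x))
    simp only [LinearMap.sum_apply, LinearMap.smul_apply, map_sum, map_smul]

/-- A splitting `τ` of the anchor becomes isotropic on subtracting `½ ρ^*⟨τ ·, τ ·⟩`. -/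
theorem nonempty_isotropicSection [SigmaCompactSpace M] : Nonempty (IsotropicSection A) := by
  obtain ⟨τ, hτ, hτs⟩ := A.exists_splitting
  refine ⟨A.mkIsotropicSection
    (fun x => τ x - (1 / 2 : ℝ) • (A.rhoStar x ∘ₗ (A.1.str.pairing x).compl₁₂ (τ x) (τ x)))
    (fun x v => ?_) (fun x v w => ?_) fun X ψ => ?_⟩
  · simp only [LinearMap.sub_apply, LinearMap.smul_apply, LinearMap.comp_apply, map_sub, map_smul,
      rho_rhoStar, hτ, smul_zero, sub_zero]
  · have h1 : ∀ u α, A.1.str.pairing x u (A.rhoStar x α) = α (A.rho x u) := fun u α => by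
      rw [A.1.str.pairing_symm, pairing_rhoStar]
    simp only [LinearMap.sub_apply, LinearMap.smul_apply, LinearMap.comp_apply, map_sub, map_smul,
      h1, pairing_rhoStar, rho_rhoStar, hτ, LinearMap.compl₁₂_apply, map_zero, smul_eq_mul,
      A.1.str.pairing_symm x (τ x w) (τ x v)]
    ring
  · let s : A.1.Sections := ⟨fun x => τ x (val X x), contMDiff_of_pairing _ (hτs X)⟩
    refine ((hτs X ψ).sub ((contMDiff_const (c := (1 / 2 : ℝ))).mul (hτs (A.rhoSec ψ) s))).congr
      fun x => ?_
    simp only [LinearMap.sub_apply, LinearMap.smul_apply, LinearMap.comp_apply, map_sub, map_smul,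
      pairing_rhoStar, LinearMap.compl₁₂_apply, smul_eq_mul]
    rw [A.1.str.pairing_symm x (τ x (val X x)) (τ x (A.rho x (ψ x)))]
    rfl

end Existence

namespace IsotropicSection

variable {A B : GenExact.{u, v} D}

/-- The Ševera form of an isotropic section. -/
def severaForm (σ : IsotropicSection A) : D.Form 3 :=
  ofTrilinear σ.curvature σ.curvature_self_left σ.curvature_self_right

theorem trilinear_severaForm (σ : IsotropicSection A) :
    trilinear σ.severaForm = σ.curvature := trilinear_ofTrilinear _ _ _

theorem isSeveraForm_severaForm (σ : IsotropicSection A) : σ.IsSeveraForm σ.severaForm := by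
  intro X Y Z x
  rw [severaForm, eval_ofTrilinear]
  change A.1.str.pairing x _ _ = A.1.str.pairing x (A.1.str.bracket _ _ x - σ.onSections _ x) _
  have h : A.1.str.pairing x (σ.onSections (LieSubalgebroid.bracket X Y) x)
      (σ.onSections Z x) = 0 := by
    rw [σ.onSections_apply, σ.onSections_apply, σ.isotropic]
  rw [map_sub, LinearMap.sub_apply, h, sub_zero]

/-- The Ševera form is closed: its differential is the defect of the Jacobi identity. -/
theorem severaForm_mem_Z3 (σ : IsotropicSection A) : σ.severaForm ∈ D.Z3 := by
  rw [mem_Z3_iff, trilinear_severaForm]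
  intro X Y Z W
  obtain ⟨φ, hφ⟩ := σ.splitEquiv.surjective (X, 0)
  obtain ⟨ψ, hψ⟩ := σ.splitEquiv.surjective (Y, 0)
  obtain ⟨χ, hχ⟩ := σ.splitEquiv.surjective (Z, 0)
  rw [splitEquiv_apply] at hφ hψ hχ
  have h := congrArg σ.split (A.1.str.jacobi φ ψ χ)
  simp only [split_add, split_bracket, hφ, hψ, hχ] at h
  have h2 := dorfman_jacobiator σ.curvature_self_left σ.curvature_self_right
    (X, 0) (Y, 0) (Z, 0) W
  rw [h, Prod.snd_add, LinearMap.add_apply] at h2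
  rw [← h2]
  ring

/-- Two isotropic sections have curvatures that differ by the differential of their difference. -/
theorem curvature_eq_add (σ σ' : IsotropicSection A) (X Y Z : D.Sections) :
    σ'.curvature X Y Z = σ.curvature X Y Z + cartan2 (difference σ σ') X Y Z := by
  have h1 := σ.pair_eq (A.1.str.bracket (σ'.onSections X) (σ'.onSections Y)) (σ'.onSections Z)
  have h2 := congrArg (fun p => p.2 Z) (σ.split_bracket (σ'.onSections X) (σ'.onSections Y))
  simp only [split_onSections_of, dorfman_snd] at h2
  rw [rhoSec_onSections, rhoSec_bracket, rhoSec_onSections, rhoSec_onSections] at h1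
  have h3 : A.1.pair (A.1.str.bracket (σ'.onSections X) (σ'.onSections Y)) (σ.onSections Z) = _ :=
    h2
  have h4 : A.1.pair (σ'.onSections Z) (σ.onSections ⁅X, Y⁆) = difference σ σ' Z ⁅X, Y⁆ := rfl
  have hs : ∀ U V, difference σ σ' U V = - difference σ σ' V U := fun U V => by
    have h := difference_self σ σ' (U + V)
    simp only [map_add, LinearMap.add_apply, difference_self, zero_add, add_zero] at h
    exact eq_neg_of_add_eq_zero_right h
  rw [curvature_apply, h1, h3, h4, hs Z, hs Y ⁅X, Z⁆, hs X ⁅Y, Z⁆, cartan2]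
  ring

/-- The class of the Ševera form does not depend on the isotropic section. -/
theorem severaForm_sub_mem_B3 (σ σ' : IsotropicSection A) :
    σ'.severaForm - σ.severaForm ∈ D.B3 := by
  refine (mem_B3_iff _).2 ⟨ofBilinear (difference σ σ') (difference_self σ σ'), fun X Y Z => ?_⟩
  have h : trilinear (σ'.severaForm - σ.severaForm) X Y Z =
      trilinear σ'.severaForm X Y Z - trilinear σ.severaForm X Y Z := rfl
  rw [h, trilinear_severaForm, trilinear_severaForm, bilinear_ofBilinear, curvature_eq_add σ σ']
  ring

/-- An isotropic section `σ` can be shifted by a `2`-form `β` to `σ + ρ^* β`. -/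
theorem exists_difference_eq (σ : IsotropicSection A) (β : D.Form 2) :
    ∃ σ' : IsotropicSection A, difference σ σ' = bilinear β := by
  let τ : ∀ x, D.fiber x →ₗ[ℝ] A.1.E x := fun x => σ.toLin x + A.rhoStar x ∘ₗ
    { toFun := fun v => dualAt (bilinear β (D.extend x v)) x
      map_add' := fun v w => LinearMap.ext fun y => by rw [map_add, map_add]; rfl
      map_smul' := fun c v => LinearMap.ext fun y => by
        rw [map_smul, ← const_smul_sections, map_smul]; rfl }
  have hτ : ∀ x v, τ x v = σ.toLin x v + A.rhoStar x (dualAt (bilinear β (D.extend x v)) x) :=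
    fun _ _ => rfl
  have hβ : ∀ x v, dualAt (bilinear β (D.extend x v)) x v = 0 := fun x v => by
    change bilinear β (D.extend x v) (D.extend x v) x = 0
    rw [bilinear_self]
    rfl
  have h1 : ∀ x u α, A.1.str.pairing x u (A.rhoStar x α) = α (A.rho x u) := fun x u α => by
    rw [A.1.str.pairing_symm, pairing_rhoStar]
  have hτX : ∀ (X : D.Sections) (x : M), τ x (val X x) =
      (σ.onSections X + A.rhoStarSec (bilinear β X)) x := fun X x => by
    change _ = σ.onSections X x + A.rhoStarSec (bilinear β X) x
    rw [hτ, σ.onSections_apply, rhoStarSec_apply]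
    congr 2
    exact LinearMap.ext fun y => bilinear_congr (bilinear β) (Y := D.extend x y)
      (Y' := D.extend x y) (val_extend x (val X x)) rfl
  have hiso : ∀ x v, A.1.str.pairing x (τ x v) (τ x v) = 0 := fun x v => by
    simp only [hτ, map_add, LinearMap.add_apply, σ.isotropic, h1, pairing_rhoStar, rho_toLin,
      rho_rhoStar, map_zero, hβ, add_zero]
  refine ⟨A.mkIsotropicSection τ (fun x v => ?_) (fun x v w => ?_) fun X ψ => ?_, ?_⟩
  · rw [hτ, map_add, rho_toLin, rho_rhoStar, add_zero]
  · have h := hiso x (v + w)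
    simp only [map_add, LinearMap.add_apply, hiso, zero_add, add_zero,
      A.1.str.pairing_symm x (τ x w) (τ x v)] at h
    linarith
  · simp only [hτX]
    exact A.1.str.pairing_smooth _ ψ
  · refine LinearMap.ext fun X => LinearMap.ext fun Y => ContMDiffMap.ext fun x => ?_
    change A.1.str.pairing x (τ x (val X x)) (σ.onSections Y x) = _
    rw [hτX]
    exact congrArg (fun p => p.2 Y x) (σ.split_onSections_add X (bilinear β X))

/-- Isotropic sections with the same curvature give an isomorphism. -/
def isoOfCurvatureEq (σ : IsotropicSection A) (σ' : IsotropicSection B)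
    (h : σ.curvature = σ'.curvature) : CourantAlgebroid.Iso A.1 B.1 where
  toEquiv x := (σ.fiberEquiv x).trans (σ'.fiberEquiv x).symm
  onSections := σ.splitEquiv.trans σ'.splitEquiv.symm
  onSections_apply s x := by
    have h1 : σ'.split (σ'.splitEquiv.symm (σ.splitEquiv s)) = σ.split s :=
      σ'.splitEquiv.apply_symm_apply _
    rw [LinearEquiv.trans_apply, LinearEquiv.eq_symm_apply, Equiv.trans_apply, fiberEquiv_apply,
      fiberEquiv_apply, h1]
  anchor_comp x v := by
    have h1 : B.rho x ((σ'.fiberEquiv x).symm (σ.fiberEquiv x v)) = A.rho x v :=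
      congrArg Prod.fst ((σ'.fiberEquiv x).apply_symm_apply (σ.fiberEquiv x v))
    exact congrArg Subtype.val h1
  pairing_comp x v w := by
    have h1 : ∀ v, B.rho x ((σ'.fiberEquiv x).symm (σ.fiberEquiv x v)) = A.rho x v := fun v =>
      congrArg Prod.fst ((σ'.fiberEquiv x).apply_symm_apply (σ.fiberEquiv x v))
    have h2 : ∀ v y, B.1.str.pairing x ((σ'.fiberEquiv x).symm (σ.fiberEquiv x v))
        (σ'.toLin x y) = A.1.str.pairing x v (σ.toLin x y) := fun v y =>
      LinearMap.congr_fun (congrArg Prod.snd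
        ((σ'.fiberEquiv x).apply_symm_apply (σ.fiberEquiv x v))) y
    rw [LinearEquiv.trans_apply, LinearEquiv.trans_apply, σ'.pairing_eq, σ.pairing_eq x v, h1, h1,
      h2, h2]
  bracket_comp s t := by
    have h1 : ∀ s, σ'.split (σ'.splitEquiv.symm (σ.splitEquiv s)) = σ.split s := fun s =>
      σ'.splitEquiv.apply_symm_apply _
    refine σ'.split_injective ?_
    simp only [Equiv.trans_apply, split_bracket, h1, h]

end IsotropicSection

end GenExact

end Courant

/-! ### Gluing the bundle `D ⊕ D^*` from frames -/

namespace Courant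

open scoped Topology
open LieSubalgebroid CourantAlgebroid

variable {n : ℕ} {M : Type u} [TopologicalSpace M] [ChartedSpace (EuclideanSpace ℝ (Fin n)) M]

/-- A family of linear maps on a finite-dimensional space is smooth as soon as it is so on every
vector. -/
theorem contMDiffOn_clm_of_apply {F G : Type*} [NormedAddCommGroup F] [NormedSpace ℝ F]
    [NormedAddCommGroup G] [NormedSpace ℝ G] [FiniteDimensional ℝ F]
    {φ : M → F →L[ℝ] G} {U : Set M}
    (h : ∀ v, ContMDiffOn (𝓡 n) 𝓘(ℝ, G) ∞ (fun x => φ x v) U) :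
    ContMDiffOn (𝓡 n) 𝓘(ℝ, F →L[ℝ] G) ∞ φ U := by
  let b := Module.finBasis ℝ F
  let c : Fin (Module.finrank ℝ F) → F →L[ℝ] ℝ := fun i => (b.coord i).toContinuousLinearMap
  have hφ : φ = fun x => ∑ i, ContinuousLinearMap.smulRightL ℝ F G (c i) (φ x (b i)) := by
    funext x
    ext v
    conv_lhs => rw [← b.sum_repr v, map_sum]
    simp [c]
  rw [hφ]
  exact contMDiffOn_finsetSum fun i _ =>
    (ContinuousLinearMap.smulRightL ℝ F G (c i)).contMDiff.comp_contMDiffOn (h (b i))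

variable [IsManifold (𝓡 n) ∞ M] {D : LieSubalgebroid n M}

namespace LieSubalgebroid

namespace LocalFrame

variable {ι : Type*} [Fintype ι] [DecidableEq ι] (Φ : D.LocalFrame ι)

/-- The coordinates on `D ⊕ D^*` given by a frame of `D` and the dual frame. -/
def coords (x : M) : D.fiber x × Module.Dual ℝ (D.fiber x) →ₗ[ℝ] (ι → ℝ) × (ι → ℝ) :=
  (LinearMap.pi fun j => Φ.coeff j x).prodMap
    (LinearMap.pi fun j => LinearMap.applyₗ (val (Φ.e j) x))

/-- The element of `D ⊕ D^*` with given coordinates. -/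
def ofCoords (x : M) : (ι → ℝ) × (ι → ℝ) →ₗ[ℝ] D.fiber x × Module.Dual ℝ (D.fiber x) :=
  (Fintype.linearCombination ℝ fun j => val (Φ.e j) x).prodMap
    (Fintype.linearCombination ℝ fun j => Φ.coeff j x)

theorem coords_fst (x : M) (w : D.fiber x × Module.Dual ℝ (D.fiber x)) (j : ι) :
    (Φ.coords x w).1 j = Φ.coeff j x w.1 := rfl

theorem coords_snd (x : M) (w : D.fiber x × Module.Dual ℝ (D.fiber x)) (j : ι) :
    (Φ.coords x w).2 j = w.2 (val (Φ.e j) x) := rfl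

theorem ofCoords_fst (x : M) (w : (ι → ℝ) × (ι → ℝ)) :
    (Φ.ofCoords x w).1 = ∑ j, w.1 j • val (Φ.e j) x := rfl

theorem ofCoords_snd (x : M) (w : (ι → ℝ) × (ι → ℝ)) (v : D.fiber x) :
    (Φ.ofCoords x w).2 v = ∑ j, w.2 j * Φ.coeff j x v := by
  change (Fintype.linearCombination ℝ (fun j => Φ.coeff j x) w.2) v = _
  simp [Fintype.linearCombination_apply]

theorem coords_ofCoords {x : M} (hx : x ∈ Φ.U) (w : (ι → ℝ) × (ι → ℝ)) :
    Φ.coords x (Φ.ofCoords x w) = w := by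
  refine Prod.ext (funext fun j => ?_) (funext fun j => ?_)
  · simp [coords_fst, ofCoords_fst, Φ.coeff_e x hx]
  · simp [coords_snd, ofCoords_snd, Φ.coeff_e x hx]

theorem ofCoords_coords {x : M} (hx : x ∈ Φ.U) (w : D.fiber x × Module.Dual ℝ (D.fiber x)) :
    Φ.ofCoords x (Φ.coords x w) = w := by
  refine Prod.ext ?_ (LinearMap.ext fun v => ?_)
  · rw [ofCoords_fst]
    exact Φ.sum_coeff x hx w.1
  · conv_rhs => rw [← Φ.sum_coeff x hx v]
    simp [ofCoords_snd, coords_snd, mul_comm]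

/-- A tangent vector field with smooth coefficients in a frame is smooth. -/
theorem contMDiffOn_of_coeff {v : ∀ x, D.fiber x}
    (hv : ∀ j, ContMDiffOn (𝓡 n) 𝓘(ℝ, ℝ) ∞ (fun x => Φ.coeff j x (v x)) Φ.U) :
    ContMDiffOn (𝓡 n) (𝓡 n).tangent ∞
      (fun x => (⟨x, (v x : TangentSpace (𝓡 n) x)⟩ : TangentBundle (𝓡 n) M)) Φ.U := by
  have h : ContMDiffOn (𝓡 n) (𝓡 n).tangent ∞ (fun x => (⟨x, ∑ j, Φ.coeff j x (v x) • (Φ.e j).1 x⟩ :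
      TangentBundle (𝓡 n) M)) Φ.U :=
    ContMDiffOn.sum_section fun j _ => (hv j).smul_section (Φ.e j).1.contMDiff.contMDiffOn
  refine h.congr fun x hx => ?_
  have := congrArg Subtype.val (Φ.sum_coeff x hx (v x))
  rw [← this]
  simp [val]

/-- The transition between the coordinates of two frames. -/
def coordChange (Φ Ψ : D.LocalFrame ι) (x : M) :
    (ι → ℝ) × (ι → ℝ) →L[ℝ] (ι → ℝ) × (ι → ℝ) :=
  (Ψ.coords x ∘ₗ Φ.ofCoords x).toContinuousLinearMap

theorem coordChange_apply (Φ Ψ : D.LocalFrame ι) (x : M) (w : (ι → ℝ) × (ι → ℝ)) :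
    coordChange Φ Ψ x w = Ψ.coords x (Φ.ofCoords x w) := rfl

theorem contMDiffOn_coords {w : ∀ x, D.fiber x × Module.Dual ℝ (D.fiber x)} {V : Set M}
    (h1 : ∀ j, ContMDiffOn (𝓡 n) 𝓘(ℝ, ℝ) ∞ (fun x => Φ.coeff j x (w x).1) V)
    (h2 : ∀ j, ContMDiffOn (𝓡 n) 𝓘(ℝ, ℝ) ∞ (fun x => (w x).2 (val (Φ.e j) x)) V) :
    ContMDiffOn (𝓡 n) 𝓘(ℝ, (ι → ℝ) × (ι → ℝ)) ∞ (fun x => Φ.coords x (w x)) V :=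
  (contMDiffOn_pi_space.2 h1).prodMk_space (contMDiffOn_pi_space.2 h2)

theorem contMDiffOn_coordChange (Φ Ψ : D.LocalFrame ι) :
    ContMDiffOn (𝓡 n) 𝓘(ℝ, (ι → ℝ) × (ι → ℝ) →L[ℝ] (ι → ℝ) × (ι → ℝ)) ∞ (coordChange Φ Ψ)
      (Φ.U ∩ Ψ.U) := by
  refine contMDiffOn_clm_of_apply fun w => Ψ.contMDiffOn_coords (fun j => ?_) fun j => ?_
  · simp only [ofCoords_fst, map_sum, map_smul, smul_eq_mul]
    exact contMDiffOn_finsetSum fun i _ =>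
      contMDiffOn_const.mul ((Ψ.smooth (Φ.e i) j).mono Set.inter_subset_right)
  · simp only [ofCoords_snd]
    exact contMDiffOn_finsetSum fun i _ =>
      contMDiffOn_const.mul ((Φ.smooth (Ψ.e j) i).mono Set.inter_subset_left)

end LocalFrame

section Model

variable {ι : Type v} [Fintype ι] [DecidableEq ι] (Φ : M → D.LocalFrame ι)
  (hΦ : ∀ x, x ∈ (Φ x).U)

/-- The vector bundle `D ⊕ D^*`, glued from a family of frames of `D`. The frame `Φ x` is used to
identify the fibre over `x` with the model fibre. -/
@[reducible]
def modelCore : VectorBundleCore ℝ M ((ι → ℝ) × (ι → ℝ)) M where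
  baseSet p := (Φ p).U
  isOpen_baseSet p := (Φ p).isOpen
  indexAt := id
  mem_baseSet_at := hΦ
  coordChange p q := LocalFrame.coordChange (Φ p) (Φ q)
  coordChange_self p _ hx w := (Φ p).coords_ofCoords hx w
  continuousOn_coordChange p q := (LocalFrame.contMDiffOn_coordChange (Φ p) (Φ q)).continuousOn
  coordChange_comp p q r x hx w := by
    rw [LocalFrame.coordChange_apply, LocalFrame.coordChange_apply, (Φ q).ofCoords_coords hx.1.2]
    rfl

instance : (modelCore Φ hΦ).IsContMDiff (𝓡 n) ∞ :=
  ⟨fun p q => LocalFrame.contMDiffOn_coordChange (Φ p) (Φ q)⟩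

/-- The identification of the fibres of the glued bundle with those of `D ⊕ D^*`. -/
def modelEquiv (x : M) :
    (modelCore Φ hΦ).Fiber x ≃ₗ[ℝ] D.fiber x × Module.Dual ℝ (D.fiber x) :=
  LinearEquiv.ofLinearMap (M := (ι → ℝ) × (ι → ℝ)) ((Φ x).ofCoords x) ((Φ x).coords x)
    (LinearMap.ext fun w => (Φ x).ofCoords_coords (hΦ x) w)
    (LinearMap.ext fun w => (Φ x).coords_ofCoords (hΦ x) w)

/-- A section of the glued bundle is smooth if and only if its coordinates in all frames are. -/
theorem contMDiff_model_iff (t : ∀ x, (modelCore Φ hΦ).Fiber x) :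
    ContMDiff (𝓡 n) ((𝓡 n).prod 𝓘(ℝ, (ι → ℝ) × (ι → ℝ))) ∞
        (fun x => (⟨x, t x⟩ : TotalSpace ((ι → ℝ) × (ι → ℝ)) (modelCore Φ hΦ).Fiber)) ↔
      ∀ p, ContMDiffOn (𝓡 n) 𝓘(ℝ, (ι → ℝ) × (ι → ℝ)) ∞
        (fun x => (Φ p).coords x (modelEquiv Φ hΦ x (t x))) (Φ p).U := by
  have key : ∀ p, MemTrivializationAtlas ((modelCore Φ hΦ).localTriv p) := fun p =>
    ⟨⟨p, rfl⟩⟩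
  constructor
  · intro h p
    exact (((modelCore Φ hΦ).localTriv p).contMDiffOn_section_iff (Φ p).isOpen subset_rfl).1
      h.contMDiffOn
  · intro h x
    refine (((modelCore Φ hΦ).localTriv x).contMDiffAt_section_iff (hΦ x)).2 ?_
    exact (h x).contMDiffAt ((Φ x).isOpen.mem_nhds (hΦ x))

/-- The smooth sections of the glued bundle. -/
abbrev ModelSections : Type (max u v) :=
  ContMDiffSection (𝓡 n) ((ι → ℝ) × (ι → ℝ)) ∞ (modelCore Φ hΦ).Fiber

/-- The component in `Γ(D)` of a section of the glued bundle. -/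
def modelFst (s : ModelSections Φ hΦ) : D.Sections where
  val := ⟨fun x => (modelEquiv Φ hΦ x (s x)).1, fun x => by
    refine ((Φ x).contMDiffOn_of_coeff (v := fun x => (modelEquiv Φ hΦ x (s x)).1)
      fun j => ?_).contMDiffAt ((Φ x).isOpen.mem_nhds (hΦ x))
    have h := (contMDiff_model_iff Φ hΦ s).1 s.contMDiff x
    exact ((ContinuousLinearMap.proj (R := ℝ) (φ := fun _ : ι => ℝ) j).comp
      (ContinuousLinearMap.fst ℝ (ι → ℝ) (ι → ℝ))).contMDiff.comp_contMDiffOn h⟩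
  property x := (modelEquiv Φ hΦ x (s x)).1.2

theorem contMDiff_modelSnd (s : ModelSections Φ hΦ) (X : D.Sections) :
    ContMDiff (𝓡 n) 𝓘(ℝ, ℝ) ∞ (fun x => (modelEquiv Φ hΦ x (s x)).2 (val X x)) := by
  intro x
  have h := (contMDiff_model_iff Φ hΦ s).1 s.contMDiff x
  have h2 : ∀ j, ContMDiffOn (𝓡 n) 𝓘(ℝ, ℝ) ∞
      (fun y => (modelEquiv Φ hΦ y (s y)).2 (val ((Φ x).e j) y)) (Φ x).U := fun j =>
    ((ContinuousLinearMap.proj (R := ℝ) (φ := fun _ : ι => ℝ) j).comp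
      (ContinuousLinearMap.snd ℝ (ι → ℝ) (ι → ℝ))).contMDiff.comp_contMDiffOn h
  refine ((contMDiffOn_finsetSum (t := Finset.univ) fun j _ =>
    ((Φ x).smooth X j).mul (h2 j)).congr fun y hy => ?_).contMDiffAt
      ((Φ x).isOpen.mem_nhds (hΦ x))
  conv_lhs => rw [← (Φ x).sum_coeff y hy (val X y), map_sum]
  simp only [map_smul, smul_eq_mul]
  rfl

variable [T2Space M]

/-- The identification of the smooth sections of the glued bundle with `Γ(D) ⊕ Ω¹(D)`. -/
def modelSecEquiv : ModelSections Φ hΦ ≃ₗ[SmoothFunction n M]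
    D.Sections × Module.Dual (SmoothFunction n M) D.Sections where
  toFun s := (modelFst Φ hΦ s,
    mkDual (fun x => (modelEquiv Φ hΦ x (s x)).2) (contMDiff_modelSnd Φ hΦ s))
  invFun w := ⟨fun x => (modelEquiv Φ hΦ x).symm (val w.1 x, dualAt w.2 x), by
    refine (contMDiff_model_iff Φ hΦ _).2 fun p => ?_
    simp only [LinearEquiv.apply_symm_apply]
    refine (Φ p).contMDiffOn_coords (fun j => (Φ p).smooth w.1 j) fun j => ?_
    simp only [dualAt_val]
    exact (w.2 ((Φ p).e j)).contMDiff.contMDiffOn⟩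
  left_inv s := ContMDiffSection.ext fun x => by
    change (modelEquiv Φ hΦ x).symm (_, dualAt (mkDual _ _) x) = s x
    rw [dualAt_mkDual]
    exact (modelEquiv Φ hΦ x).symm_apply_apply (s x)
  right_inv w := by
    refine Prod.ext (sections_ext fun x => ?_) (LinearMap.ext fun X => ContMDiffMap.ext fun x => ?_)
    · exact congrArg Prod.fst ((modelEquiv Φ hΦ x).apply_symm_apply (val w.1 x, dualAt w.2 x))
    · rw [mkDual_apply]
      change (modelEquiv Φ hΦ x ((modelEquiv Φ hΦ x).symm (val w.1 x, dualAt w.2 x))).2 _ = _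
      rw [LinearEquiv.apply_symm_apply, dualAt_val]
  map_add' s t := by
    refine Prod.ext (sections_ext fun x => ?_) (LinearMap.ext fun X => ContMDiffMap.ext fun x => ?_)
    · exact congrArg Prod.fst (map_add (modelEquiv Φ hΦ x) (s x) (t x))
    · exact LinearMap.congr_fun (congrArg Prod.snd (map_add (modelEquiv Φ hΦ x) (s x) (t x))) _
  map_smul' f s := by
    refine Prod.ext (sections_ext fun x => ?_) (LinearMap.ext fun X => ContMDiffMap.ext fun x => ?_)
    · exact congrArg Prod.fst (map_smul (modelEquiv Φ hΦ x) (f x) (s x))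
    · exact LinearMap.congr_fun (congrArg Prod.snd (map_smul (modelEquiv Φ hΦ x) (f x) (s x))) _

theorem modelEquiv_apply (s : ModelSections Φ hΦ) (x : M) : modelEquiv Φ hΦ x (s x) =
    (val (modelSecEquiv Φ hΦ s).1 x, dualAt (modelSecEquiv Φ hΦ s).2 x) :=
  Prod.ext rfl (dualAt_mkDual (fun x => (modelEquiv Φ hΦ x (s x)).2)
    (contMDiff_modelSnd Φ hΦ s) x).symm

end Model

end LieSubalgebroid

end Courant

/-! ### The Courant algebroid of a closed three-form -/

namespace Courant

open scoped Topology
open LieSubalgebroid CourantAlgebroid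

variable {n : ℕ} {M : Type u} [TopologicalSpace M] [ChartedSpace (EuclideanSpace ℝ (Fin n)) M]
  [IsManifold (𝓡 n) ∞ M] {D : LieSubalgebroid n M}

namespace LieSubalgebroid

theorem lie_algebraMap (Z : D.Sections) (c : ℝ) : ⁅Z, algebraMap ℝ (SmoothFunction n M) c⁆ = 0 :=
  ContMDiffMap.ext fun x => by
    rw [lie_function_apply]
    change mfderiv (𝓡 n) 𝓘(ℝ, ℝ) (fun _ : M => c) x (Z.1 x) = 0
    rw [mfderiv_const]
    rfl

section Model

variable {ι : Type v} [Fintype ι] [DecidableEq ι] (Φ : M → D.LocalFrame ι)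
  (hΦ : ∀ x, x ∈ (Φ x).U)

/-- The canonical pairing `⟨(v, α), (w, β)⟩ = β v + α w`. -/
def modelPairing (x : M) :
    (modelCore Φ hΦ).Fiber x →ₗ[ℝ] (modelCore Φ hΦ).Fiber x →ₗ[ℝ] ℝ :=
  LinearMap.mk₂ ℝ (fun v w => (modelEquiv Φ hΦ x w).2 (modelEquiv Φ hΦ x v).1 +
      (modelEquiv Φ hΦ x v).2 (modelEquiv Φ hΦ x w).1)
    (fun v v' w => by
      simp only [map_add, Prod.fst_add, Prod.snd_add, LinearMap.add_apply]; ring)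
    (fun c v w => by
      simp only [map_smul, Prod.smul_fst, Prod.smul_snd, LinearMap.smul_apply, smul_eq_mul]; ring)
    (fun v w w' => by
      simp only [map_add, Prod.fst_add, Prod.snd_add, LinearMap.add_apply]; ring)
    (fun c v w => by
      simp only [map_smul, Prod.smul_fst, Prod.smul_snd, LinearMap.smul_apply, smul_eq_mul]; ring)

theorem modelPairing_apply (x : M) (v w : (modelCore Φ hΦ).Fiber x) :
    modelPairing Φ hΦ x v w = (modelEquiv Φ hΦ x w).2 (modelEquiv Φ hΦ x v).1 +
      (modelEquiv Φ hΦ x v).2 (modelEquiv Φ hΦ x w).1 := rfl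

/-- The projection `D ⊕ D^* → D ⊂ TM`. -/
def modelAnchor (x : M) : (modelCore Φ hΦ).Fiber x →ₗ[ℝ] TangentSpace (𝓡 n) x :=
  (D.fiber x).subtype ∘ₗ LinearMap.fst ℝ _ _ ∘ₗ (modelEquiv Φ hΦ x).toLinearMap

theorem modelAnchor_apply (x : M) (v : (modelCore Φ hΦ).Fiber x) :
    modelAnchor Φ hΦ x v = (modelEquiv Φ hΦ x v).1 := rfl

theorem modelPairing_nondegenerate (x : M) (v : (modelCore Φ hΦ).Fiber x)
    (h : ∀ w, modelPairing Φ hΦ x v w = 0) : v = 0 := by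
  refine (modelEquiv Φ hΦ x).map_eq_zero_iff.1 (Prod.ext ?_ (LinearMap.ext fun w => ?_))
  · refine (Module.forall_dual_apply_eq_zero_iff ℝ _).1 fun α => ?_
    have := h ((modelEquiv Φ hΦ x).symm (0, α))
    simpa [modelPairing_apply] using this
  · have := h ((modelEquiv Φ hΦ x).symm (w, 0))
    simpa [modelPairing_apply] using this

theorem range_modelAnchor (x : M) : LinearMap.range (modelAnchor Φ hΦ x) = D.fiber x := by
  refine le_antisymm ?_ fun w hw => ?_
  · rintro _ ⟨v, rfl⟩
    exact (modelEquiv Φ hΦ x v).1.2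
  · refine ⟨(modelEquiv Φ hΦ x).symm (⟨w, hw⟩, 0), ?_⟩
    rw [modelAnchor_apply, LinearEquiv.apply_symm_apply]

theorem modelAnchor_eq_zero_iff (x : M) (v : (modelCore Φ hΦ).Fiber x) :
    modelAnchor Φ hΦ x v = 0 ↔ ∃ α : Module.Dual ℝ (LinearMap.range (modelAnchor Φ hΦ x)),
      ∀ w, modelPairing Φ hΦ x v w = α ⟨modelAnchor Φ hΦ x w, LinearMap.mem_range_self _ w⟩ := by
  constructor
  · intro hv
    have hv : (modelEquiv Φ hΦ x v).1 = 0 := Subtype.ext hv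
    refine ⟨(modelEquiv Φ hΦ x v).2 ∘ₗ Submodule.inclusion (range_modelAnchor Φ hΦ x).le,
      fun w => ?_⟩
    rw [modelPairing_apply, hv, map_zero, zero_add]
    rfl
  · rintro ⟨α, hα⟩
    have h0 : (modelEquiv Φ hΦ x v).1 = 0 := by
      refine (Module.forall_dual_apply_eq_zero_iff ℝ _).1 fun β => ?_
      have h := hα ((modelEquiv Φ hΦ x).symm (0, β))
      have e : modelPairing Φ hΦ x v ((modelEquiv Φ hΦ x).symm (0, β)) =
          β (modelEquiv Φ hΦ x v).1 := by
        simp [modelPairing_apply]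
      refine (e.symm.trans h).trans ((congrArg α (Subtype.ext ?_)).trans (map_zero α))
      change modelAnchor Φ hΦ x _ = 0
      rw [modelAnchor_apply, LinearEquiv.apply_symm_apply]
      rfl
    rw [modelAnchor_apply, h0]
    rfl

variable [T2Space M] (C : D.Sections →ₗ[SmoothFunction n M]
    D.Sections →ₗ[SmoothFunction n M] D.Sections →ₗ[SmoothFunction n M] SmoothFunction n M)

/-- The Dorfman bracket twisted by `C` on the sections of the glued bundle. -/
def twistedBracket (s t : ModelSections Φ hΦ) : ModelSections Φ hΦ :=
  (modelSecEquiv Φ hΦ).symm (dorfman C (modelSecEquiv Φ hΦ s) (modelSecEquiv Φ hΦ t))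

theorem modelSecEquiv_twistedBracket (s t : ModelSections Φ hΦ) :
    modelSecEquiv Φ hΦ (twistedBracket Φ hΦ C s t) =
      dorfman C (modelSecEquiv Φ hΦ s) (modelSecEquiv Φ hΦ t) :=
  (modelSecEquiv Φ hΦ).apply_symm_apply _

theorem twistedBracket_add_left (s s' t : ModelSections Φ hΦ) :
    twistedBracket Φ hΦ C (s + s') t =
      twistedBracket Φ hΦ C s t + twistedBracket Φ hΦ C s' t := by
  apply (modelSecEquiv Φ hΦ).injective
  rw [map_add]
  simp only [modelSecEquiv_twistedBracket]
  rw [map_add, dorfman_add_left]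

theorem twistedBracket_add_right (s t t' : ModelSections Φ hΦ) :
    twistedBracket Φ hΦ C s (t + t') =
      twistedBracket Φ hΦ C s t + twistedBracket Φ hΦ C s t' := by
  apply (modelSecEquiv Φ hΦ).injective
  rw [map_add]
  simp only [modelSecEquiv_twistedBracket]
  rw [map_add, dorfman_add_right]

theorem twistedBracket_smul_right (f : SmoothFunction n M) (s t : ModelSections Φ hΦ) :
    twistedBracket Φ hΦ C s (f • t) =
      ⁅(modelSecEquiv Φ hΦ s).1, f⁆ • t + f • twistedBracket Φ hΦ C s t := by
  apply (modelSecEquiv Φ hΦ).injective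
  rw [map_add, map_smul, map_smul]
  simp only [modelSecEquiv_twistedBracket]
  rw [map_smul, dorfman_smul_right]

theorem twistedBracket_const_smul_left (c : ℝ) (s t : ModelSections Φ hΦ) :
    twistedBracket Φ hΦ C (c • s) t = c • twistedBracket Φ hΦ C s t := by
  rw [← algebraMap_smul_section, ← algebraMap_smul_section]
  apply (modelSecEquiv Φ hΦ).injective
  rw [map_smul]
  simp only [modelSecEquiv_twistedBracket]
  rw [map_smul, dorfman_smul_left fun Z => lie_algebraMap Z c]

theorem twistedBracket_const_smul_right (c : ℝ) (s t : ModelSections Φ hΦ) :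
    twistedBracket Φ hΦ C s (c • t) = c • twistedBracket Φ hΦ C s t := by
  rw [← algebraMap_smul_section, ← algebraMap_smul_section, twistedBracket_smul_right,
    lie_algebraMap, zero_smul, zero_add]

theorem modelPairing_sections (s t : ModelSections Φ hΦ) (x : M) :
    modelPairing Φ hΦ x (s x) (t x) = ((modelSecEquiv Φ hΦ t).2 (modelSecEquiv Φ hΦ s).1 +
      (modelSecEquiv Φ hΦ s).2 (modelSecEquiv Φ hΦ t).1) x := by
  rw [modelPairing_apply, modelEquiv_apply, modelEquiv_apply, dualAt_val, dualAt_val]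
  rfl

theorem dirDeriv_modelPairing_self (s : ModelSections Φ hΦ) (x : M) (w : TangentSpace (𝓡 n) x) :
    dirDeriv (fun y => modelPairing Φ hΦ y (s y) (s y)) x w =
      2 * dirDeriv ((modelSecEquiv Φ hΦ s).2 (modelSecEquiv Φ hΦ s).1) x w := by
  have h : (fun y => modelPairing Φ hΦ y (s y) (s y)) =
      ⇑((modelSecEquiv Φ hΦ s).2 (modelSecEquiv Φ hΦ s).1) +
        ⇑((modelSecEquiv Φ hΦ s).2 (modelSecEquiv Φ hΦ s).1) :=
    funext fun y => modelPairing_sections Φ hΦ s s y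
  rw [h, dirDeriv_add, two_mul]

theorem modelAnchor_section (s : ModelSections Φ hΦ) (x : M) :
    modelAnchor Φ hΦ x (s x) = (modelSecEquiv Φ hΦ s).1.1 x := rfl

variable {C}

theorem modelPairing_twistedBracket_self (h12 : ∀ X Z, C X X Z = 0) (s : ModelSections Φ hΦ)
    (x : M) (w : (modelCore Φ hΦ).Fiber x) :
    modelPairing Φ hΦ x (twistedBracket Φ hΦ C s s x) w =
      (1 / 2) * dirDeriv (fun y => modelPairing Φ hΦ y (s y) (s y)) x (modelAnchor Φ hΦ x w) := by
  obtain ⟨t, rfl⟩ := exists_section_apply_eq (n := n) (F := (ι → ℝ) × (ι → ℝ)) x w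
  rw [modelPairing_sections, modelSecEquiv_twistedBracket, dorfman_self_snd h12, dorfman_self_fst,
    map_zero, zero_add, lie_function_apply, dirDeriv_modelPairing_self, modelAnchor_section]
  ring

theorem modelPairing_twistedBracket_invariant (h23 : ∀ X Z, C X Z Z = 0)
    (s t : ModelSections Φ hΦ) (x : M) :
    dirDeriv (fun y => modelPairing Φ hΦ y (t y) (t y)) x (modelAnchor Φ hΦ x (s x)) =
      2 * modelPairing Φ hΦ x (twistedBracket Φ hΦ C s t x) (t x) := by
  rw [modelPairing_sections, modelSecEquiv_twistedBracket, add_comm,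
    ← dorfman_invariant h23 (modelSecEquiv Φ hΦ s) (modelSecEquiv Φ hΦ t), lie_function_apply,
    dirDeriv_modelPairing_self, modelAnchor_section]

theorem twistedBracket_jacobi (h12 : ∀ X Z, C X X Z = 0) (h23 : ∀ X Z, C X Z Z = 0)
    (hd : ∀ X Y Z W, cartan3 C X Y Z W = 0) (s t r : ModelSections Φ hΦ) :
    twistedBracket Φ hΦ C s (twistedBracket Φ hΦ C t r) =
      twistedBracket Φ hΦ C (twistedBracket Φ hΦ C s t) r +
        twistedBracket Φ hΦ C t (twistedBracket Φ hΦ C s r) := by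
  apply (modelSecEquiv Φ hΦ).injective
  rw [map_add]
  simp only [modelSecEquiv_twistedBracket]
  exact dorfman_jacobi h12 h23 hd _ _ _

variable (h12 : ∀ X Z, C X X Z = 0) (h23 : ∀ X Z, C X Z Z = 0)
  (hd : ∀ X Y Z W, cartan3 C X Y Z W = 0)

/-- The Courant algebroid structure on `D ⊕ D^*` whose bracket is the Dorfman bracket twisted by a
closed `3`-form. -/
def modelStructure : CourantStructure n ((ι → ℝ) × (ι → ℝ)) (modelCore Φ hΦ).Fiber where
  anchor := modelAnchor Φ hΦ
  pairing := modelPairing Φ hΦ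
  bracket := LinearMap.mk₂ ℝ (twistedBracket Φ hΦ C) (twistedBracket_add_left Φ hΦ C)
    (twistedBracket_const_smul_left Φ hΦ C) (twistedBracket_add_right Φ hΦ C)
    (twistedBracket_const_smul_right Φ hΦ C)
  anchor_smooth s := (modelFst Φ hΦ s).1.contMDiff
  pairing_smooth s t := by
    simp only [modelPairing_sections]
    exact ContMDiffMap.contMDiff _
  pairing_symm x v w := add_comm _ _
  pairing_nondegenerate := modelPairing_nondegenerate Φ hΦ
  jacobi := twistedBracket_jacobi Φ hΦ h12 h23 hd
  leibniz s t r f hf hr x := by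
    let g : SmoothFunction n M := ⟨f, hf⟩
    obtain rfl : r = g • t := ContMDiffSection.ext hr
    rw [LinearMap.mk₂_apply, twistedBracket_smul_right]
    rfl
  bracket_self := modelPairing_twistedBracket_self Φ hΦ h12
  invariant := modelPairing_twistedBracket_invariant Φ hΦ h23

/-- The bundle `D ⊕ D^*` with the bracket twisted by a closed `3`-form, as a generalized exact
Courant algebroid. -/
def model : GenExact.{u, v} D where
  val :=
    { F := (ι → ℝ) × (ι → ℝ)
      E := (modelCore Φ hΦ).Fiber
      str := modelStructure Φ hΦ h12 h23 hd }
  property := ⟨⟨⟨D.rank, fun x => (congrArg (fun V : Submodule ℝ _ => Module.finrank ℝ V)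
    (range_modelAnchor Φ hΦ x)).trans (D.finrank_fiber x)⟩, modelAnchor_eq_zero_iff Φ hΦ⟩,
      range_modelAnchor Φ hΦ⟩

/-- The inclusion of `D` in `D ⊕ D^*`. -/
def modelSplitting : GenExact.IsotropicSection (model Φ hΦ h12 h23 hd) where
  toLin x := (modelEquiv Φ hΦ x).symm.toLinearMap ∘ₗ LinearMap.inl ℝ _ _
  onSections X := (modelSecEquiv Φ hΦ).symm (X, 0)
  onSections_apply X x := by
    have h : dualAt (0 : Module.Dual (SmoothFunction n M) D.Sections) x = 0 := rfl
    change (modelEquiv Φ hΦ x).symm (val X x, dualAt 0 x) = _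
    rw [h]
    rfl
  anchor_toLin x v := congrArg (fun w => (w.1 : TangentSpace (𝓡 n) x))
    ((modelEquiv Φ hΦ x).apply_symm_apply (v, 0))
  isotropic x v w := by
    change modelPairing Φ hΦ x ((modelEquiv Φ hΦ x).symm (v, 0))
      ((modelEquiv Φ hΦ x).symm (w, 0)) = 0
    simp [modelPairing_apply]

theorem curvature_modelSplitting : (modelSplitting Φ hΦ h12 h23 hd).curvature = C := by
  refine LinearMap.ext fun X => LinearMap.ext fun Y => LinearMap.ext fun Z =>
    ContMDiffMap.ext fun x => ?_
  change modelPairing Φ hΦ x (twistedBracket Φ hΦ C ((modelSecEquiv Φ hΦ).symm (X, 0))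
    ((modelSecEquiv Φ hΦ).symm (Y, 0)) x) ((modelSecEquiv Φ hΦ).symm (Z, 0) x) = _
  rw [modelPairing_sections, modelSecEquiv_twistedBracket]
  simp only [LinearEquiv.apply_symm_apply, dorfman_snd]
  simp

end Model

/-- Every closed `3`-form on `D` is the curvature of an isotropic section. -/
theorem exists_curvature_eq [T2Space M] {C : D.Sections →ₗ[SmoothFunction n M]
    D.Sections →ₗ[SmoothFunction n M] D.Sections →ₗ[SmoothFunction n M] SmoothFunction n M}
    (h12 : ∀ X Z, C X X Z = 0) (h23 : ∀ X Z, C X Z Z = 0)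
    (hd : ∀ X Y Z W, cartan3 C X Y Z W = 0) :
    ∃ (A : GenExact.{u, v} D) (σ : GenExact.IsotropicSection A), σ.curvature = C := by
  have h : Fintype.card (ULift.{v} (Fin D.rank)) = D.rank := by simp
  -- The index type of the frames lives in `Type v`, as the fibres of the bundle have to.
  choose Φ hΦ using fun x : M => exists_localFrame_at (D := D) h x
  exact ⟨_, _, curvature_modelSplitting Φ hΦ h12 h23 hd⟩

end LieSubalgebroid

end Courant

/-! ### The Ševera class -/

namespace Courant

open scoped Topology
open LieSubalgebroid CourantAlgebroid

variable {n : ℕ} {M : Type u} [TopologicalSpace M] [ChartedSpace (EuclideanSpace ℝ (Fin n)) M]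
  [IsManifold (𝓡 n) ∞ M] {D : LieSubalgebroid n M}

namespace GenExact

variable [T2Space M]

/-- The class in `H³(D)` of the Ševera form of an isotropic section. -/
def IsotropicSection.severaClass {A : GenExact.{u, v} D} (σ : IsotropicSection A) : D.H3 :=
  Submodule.Quotient.mk ⟨σ.severaForm, σ.severaForm_mem_Z3⟩

theorem IsotropicSection.severaClass_eq_iff {A B : GenExact.{u, v} D} (σ : IsotropicSection A)
    (τ : IsotropicSection B) :
    τ.severaClass = σ.severaClass ↔ τ.severaForm - σ.severaForm ∈ D.B3 :=
  Submodule.Quotient.eq _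

theorem IsotropicSection.severaClass_eq {A : GenExact.{u, v} D} (σ τ : IsotropicSection A) :
    σ.severaClass = τ.severaClass :=
  (severaClass_eq_iff τ σ).2 (severaForm_sub_mem_B3 τ σ)

theorem IsotropicSection.severaClass_eq_of_curvature_eq {A B : GenExact.{u, v} D}
    {σ : IsotropicSection A} {τ : IsotropicSection B} (h : σ.curvature = τ.curvature) :
    σ.severaClass = τ.severaClass := by
  have h' : σ.severaForm = τ.severaForm := form_three_ext fun X Y Z => by
    rw [trilinear_severaForm, trilinear_severaForm, h]
  rw [severaClass_eq_iff, h', sub_self]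
  exact zero_mem _

/-- If the Ševera classes agree, then the splitting of one of the algebroids can be changed so that
the curvatures agree. -/
theorem IsotropicSection.nonempty_iso {A B : GenExact.{u, v} D} {σ : IsotropicSection A}
    {τ : IsotropicSection B} (h : σ.severaClass = τ.severaClass) :
    Nonempty (CourantAlgebroid.Iso A.1 B.1) := by
  obtain ⟨β, hβ⟩ := (mem_B3_iff _).1 ((severaClass_eq_iff τ σ).1 h)
  obtain ⟨τ', hτ'⟩ := exists_difference_eq τ β
  refine ⟨isoOfCurvatureEq σ τ' (LinearMap.ext fun X => LinearMap.ext fun Y =>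
    LinearMap.ext fun Z => ?_)⟩
  have e : trilinear (σ.severaForm - τ.severaForm) X Y Z =
      trilinear σ.severaForm X Y Z - trilinear τ.severaForm X Y Z := rfl
  rw [curvature_eq_add τ τ', hτ', ← hβ, e, trilinear_severaForm, trilinear_severaForm]
  ring

variable [SigmaCompactSpace M]

variable (D) in
/-- The Ševera class of an isomorphism class of generalized exact Courant algebroids. -/
def severaMap : IsoClasses.{u, v} D → D.H3 :=
  Quotient.lift (fun A => (nonempty_isotropicSection A).some.severaClass) fun A B hAB => by
    obtain ⟨Ψ⟩ : Nonempty (CourantAlgebroid.Iso A.1 B.1) := hAB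
    obtain ⟨τ, hτ⟩ := IsotropicSection.exists_curvature_eq_of_iso Ψ
      (nonempty_isotropicSection A).some
    exact (IsotropicSection.severaClass_eq_of_curvature_eq hτ.symm).trans (τ.severaClass_eq _)

theorem severaMap_isoClass {A : GenExact.{u, v} D} (σ : IsotropicSection A) :
    severaMap D A.isoClass = σ.severaClass :=
  IsotropicSection.severaClass_eq _ _

theorem severaMap_injective : Function.Injective (severaMap.{u, v} D) := by
  rintro ⟨A⟩ ⟨B⟩ h
  exact Quotient.sound (IsotropicSection.nonempty_iso h)

theorem severaMap_surjective : Function.Surjective (severaMap.{u, v} D) := by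
  intro c
  obtain ⟨⟨θ, hθ⟩, rfl⟩ := Submodule.Quotient.mk_surjective _ c
  obtain ⟨A, σ, hσ⟩ := exists_curvature_eq.{u, v} (trilinear_self_left θ) (trilinear_self_right θ)
    ((mem_Z3_iff θ).1 hθ)
  refine ⟨A.isoClass, (severaMap_isoClass σ).trans ?_⟩
  have h : σ.severaForm = θ := form_three_ext fun X Y Z => by rw [σ.trilinear_severaForm, hσ]
  exact congrArg Submodule.Quotient.mk (Subtype.ext h)

end GenExact

end Courant

end

theorem propositionP {n : ℕ} {M : Type u} [TopologicalSpace M]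
    [ChartedSpace (EuclideanSpace ℝ (Fin n)) M] [IsManifold (𝓡 n) ∞ M]
    [T2Space M] [SecondCountableTopology M] (D : Courant.LieSubalgebroid n M) :
    (∀ A : Courant.GenExact.{u, v} D, Nonempty (Courant.GenExact.IsotropicSection A)) ∧
    ∃ Φ : Courant.GenExact.IsoClasses.{u, v} D ≃ D.H3,
      ∀ (A : Courant.GenExact.{u, v} D) (σ : Courant.GenExact.IsotropicSection A),
        ∃ C : D.Z3, σ.IsSeveraForm C.1 ∧
          Φ A.isoClass = Submodule.Quotient.mk C := by
  have : LocallyCompactSpace M := ChartedSpace.locallyCompactSpace (EuclideanSpace ℝ (Fin n)) M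
  exact ⟨fun A => Courant.GenExact.nonempty_isotropicSection A,
    Equiv.ofBijective (Courant.GenExact.severaMap D)
      ⟨Courant.GenExact.severaMap_injective, Courant.GenExact.severaMap_surjective⟩,
    fun A σ => ⟨⟨σ.severaForm, σ.severaForm_mem_Z3⟩, σ.isSeveraForm_severaForm,
      Courant.GenExact.severaMap_isoClass σ⟩⟩
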